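/- **Proposition (space-fractional EPD equation).** Let $d\ge 1$, $\beta\in(0,2]$, $\lambda>0$, and use the Fourier transform $\hat f(\xi)=\int_{\mathbb R^d}e^{i\langle x,\xi\rangle}f(x)\,dx$ on $L^2(\mathbb R^d)$. Let $A=(-\Delta)^{\beta/2}$ be the operator with $\widehat{Af}(\xi)=\|\xi\|^{\beta}\hat f(\xi)$, and let $f\in L^2(\mathbb R^d)$ (complex-valued) satisfy $\int(1+\|\xi\|^\beta)|\hat f(\xi)|^2\,d\xi<\infty$. For a coefficient $c$ consider the Cauchy problem $$u''+c(t)\,u'+Au=0\quad(t>0),\qquad u(0)=f,\quad u'(0)=0 .$$ A weak solution is a map $u\in C^1([0,\infty);L^2(\mathbb R^d))$ satisfying the initial conditions, with $\int(1+\|\xi\|^\beta)|\widehat{u(t)}(\xi)|^2\,d\xi<\infty$ for all $t\ge0$, such that for every $g\in L^2(\mathbb R^d)$ with $\int(1+\|\xi\|^\beta)|\hat g|^2\,d\xi<\infty$ and all $t>0$, $$\frac{d}{dt}\langle g,u'(t)\rangle+c(t)\langle g,u'(t)\rangle+(2\pi)^{-d}\int_{\mathbb R^d}\|\xi\|^\beta\,\overline{\hat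 g(\xi)}\,\widehat{u(t)}(\xi)\,d\xi=0 .$$ A strong solution is a map $u\in C^1([0,\infty);L^2)\cap C^2((0,\infty);L^2)$ satisfying the initial conditions, with $\|\xi\|^\beta\widehat{u(t)}\in L^2$ and the equation holding in $L^2$ for all $t>0$. The EPD problem ($c(t)=2\lambda/t$) has a unique weak solution $u$, and the wave problem ($c=0$) has a unique weak solution $\bar u$. If moreover $\|\xi\|^\beta\hat f\in L^2(\mathbb R^d)$, then $u$ and $\bar u$ are also the unique strong solutions. Furthermore: 1. For every $t>0$ and almost every $\xi\in\mathbb R^d$, $$\hat u(t,\xi)=\left(\frac{2}{t\|\xi\|^{\beta/2}}\right)^{\lambda-\frac12}\Gamma\left(\lambda+\tfrac12\right)J_{\lambda-\frac12}\left(t\|\xi\|^{\beta/2}\right)\hat f(\xi)$$ $$=\frac{1}{B(\lambda,\frac12)\,t}\int_{-t}^{t}\left(1-\frac{w^2}{t^2}\right)^{\lambda-1}\frac{e^{i\|\xi\|^{\beta/2}w}+e^{-i\|\xi\|^{\beta/2}w}}{2}\,\hat f(\xi)\,dw,$$ where $J_\nu$ is the Bessel function of the first kind, $B$ is the Beta function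 and the integral converges absolutely. 2. $\hat{\bar u}(t,\xi)=\cos(t\|\xi\|^{\beta/2})\hat f(\xi)$ for every $t\ge0$ and almost every $\xi$. 3. Let $\mathfrak X$ be a random variable with the Beta$(\frac12,\lambda)$ distribution. Then for every $t\ge 0$, $\bar u(t\sqrt{\mathfrak X})$ is Bochner integrable in $L^2(\mathbb R^d)$ and $u(t)=\mathbb E[\bar u(t\sqrt{\mathfrak X})]$. Moreover, for every jointly measurable version of $(s,x)\mapsto\bar u(s,x)$ and every $t\ge0$, $u(t,x)=\mathbb E[\bar u(t\sqrt{\mathfrak X},x)]$ for almost every $x\in\mathbb R^d$, with an integrable random variable under the expectation. -/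

import Mathlib

open MeasureTheory ProbabilityTheory Set FourierTransform

noncomputable section

namespace FracEPD

/-- The Euclidean space `ℝ^d`. -/
abbrev Space (d : ℕ) : Type := EuclideanSpace ℝ (Fin d)

/-- The complex Hilbert space `L²(ℝ^d, dx)`. -/
abbrev L2 (d : ℕ) : Type := Lp (α := Space d) ℂ 2

/-- The Fourier transform on `L²(ℝ^d)` in the convention `f̂(ξ) = ∫ e^{i⟨x,ξ⟩} f(x) dx`.
Mathlib's `𝓕` is `∫ e^{-2πi⟨x,η⟩} f(x) dx`, hence the evaluation at `η = -ξ/(2π)`. -/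
def hat {d : ℕ} (f : L2 d) (ξ : Space d) : ℂ :=
  (𝓕 f : L2 d) (-((2 * Real.pi)⁻¹ • ξ))

/-- `∫ (1 + ‖ξ‖^β) |f̂(ξ)|² dξ < ∞`. -/
def EnergyDomain {d : ℕ} (β : ℝ) (f : L2 d) : Prop :=
  Integrable (fun ξ : Space d => (1 + ‖ξ‖ ^ β) * ‖hat f ξ‖ ^ 2)

/-- The sesquilinear form `(2π)^{-d} ∫ ‖ξ‖^β conj(ĝ(ξ)) û(ξ) dξ` of the operator `(-Δ)^{β/2}`;
the factor is the one of Plancherel's identity in this convention. -/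
def energyForm {d : ℕ} (β : ℝ) (g u : L2 d) : ℂ :=
  ((((2 * Real.pi) ^ d)⁻¹ : ℝ) : ℂ) *
    ∫ ξ : Space d, ((‖ξ‖ ^ β : ℝ) : ℂ) * ((starRingEnd ℂ) (hat g ξ) * hat u ξ)

/-- `h = (-Δ)^{β/2} g` in `L²(ℝ^d)`: the Fourier transform of `h` is `‖ξ‖^β ĝ(ξ)`. In particular
`g` lies in the domain of the self-adjoint operator `(-Δ)^{β/2}` iff such an `h` exists. -/
def IsFracLaplacian {d : ℕ} (β : ℝ) (g h : L2 d) : Prop :=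
  hat h =ᵐ[volume] fun ξ => ((‖ξ‖ ^ β : ℝ) : ℂ) * hat g ξ

/-- Weak (variational) solution on `[0,∞)` of
`u'' + c(t) u' + (-Δ)^{β/2} u = 0` for `t > 0`, `u(0) = f`, `u'(0) = 0`:
`u ∈ C¹([0,∞); L²)` takes values in the form domain of `(-Δ)^{β/2}`, and the equation holds
when tested against every element of the form domain. Here `v` is `u'`. -/
def IsWeakSolution {d : ℕ} (β : ℝ) (c : ℝ → ℝ) (f : L2 d) (u : ℝ → L2 d) : Prop :=
  ∃ v : ℝ → L2 d,
    (∀ t : ℝ, 0 ≤ t → HasDerivWithinAt u (v t) (Ici 0) t) ∧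
    ContinuousOn v (Ici 0) ∧
    u 0 = f ∧ v 0 = 0 ∧
    (∀ t : ℝ, 0 ≤ t → EnergyDomain β (u t)) ∧
    ∀ g : L2 d, EnergyDomain β g → ∀ t : ℝ, 0 < t →
      HasDerivAt (fun s => inner ℂ g (v s))
        (-((c t : ℂ) * inner ℂ g (v t)) - energyForm β g (u t)) t

/-- Strong solution on `[0,∞)` of
`u'' + c(t) u' + (-Δ)^{β/2} u = 0` for `t > 0`, `u(0) = f`, `u'(0) = 0`:
`u ∈ C¹([0,∞); L²) ∩ C²((0,∞); L²)`, and for `t > 0` the value `u(t)` is in the domain of the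
operator `(-Δ)^{β/2}` and the equation is an identity in `L²`. Here `v` is `u'`, `a` is `u''`. -/
def IsStrongSolution {d : ℕ} (β : ℝ) (c : ℝ → ℝ) (f : L2 d) (u : ℝ → L2 d) : Prop :=
  ∃ v a : ℝ → L2 d,
    (∀ t : ℝ, 0 ≤ t → HasDerivWithinAt u (v t) (Ici 0) t) ∧
    ContinuousOn v (Ici 0) ∧
    u 0 = f ∧ v 0 = 0 ∧
    (∀ t : ℝ, 0 < t → HasDerivAt v (a t) t) ∧
    ContinuousOn a (Ioi 0) ∧
    ∀ t : ℝ, 0 < t → ∃ h : L2 d, IsFracLaplacian β (u t) h ∧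
      a t + (c t : ℂ) • v t + h = 0

/-- The coefficient `2λ/t` of the Euler-Poisson-Darboux equation. -/
def epdCoeff (lam : ℝ) (t : ℝ) : ℝ := 2 * lam / t

/-- The coefficient `0` of the wave equation. -/
def waveCoeff (_t : ℝ) : ℝ := 0

/-- The Bessel function of the first kind `J_ν(z)`, for real order and `z > 0`. -/
def besselJ (ν z : ℝ) : ℝ :=
  ∑' k : ℕ, (-1) ^ k / ((k.factorial : ℝ) * Real.Gamma (ν + k + 1)) * (z / 2) ^ (2 * (k : ℝ) + ν)

end FracEPD

end

/-! On the Fourier side both problems decouple. With `ω = ‖ξ‖^{β/2}`, each frequency satisfies `y''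
+ c(t) y' + ω² y = 0`, and since `t c(t)` is a constant `a`, the solution is `φ(tω)` for one scalar
profile with `φ'' + (a/z) φ' + φ = 0`, `φ(0) = 1`, `φ'(0) = 0`. For the wave equation `φ = cos`. For
EPD the profile is taken to be `φ(z) = E cos(z√X)` with `X` of law Beta(1/2, λ). Expanding the
cosine, the ODE (`epdProfile_ode`) reduces to the recursion of the Beta moments (`betaMoment_succ`).
Starting from the average makes the stochastic representation nearly a definition and bounds `φ`,
`φ'`, `φ''` by one.

`IsProfile` collects what existence needs, with the ODE multiplied by `z` so that it also makes
sense at frequency zero. The bounds by one let powers of `ω` dominate the multipliers, so dominated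
convergence in `L²` gives the time derivatives. Each derivative costs one power of `ω`: one is
available in the form domain, two in the operator domain (`isWeakSolution_evolve`,
`isStrongSolution_evolve`).

Uniqueness (`IsWeakSolution.eqOn`) is the energy method. Restricting to frequencies `ω ≤ N` turns
the operator into a bounded one, where a weak solution is automatically strong and `‖u'‖² + ⟨Bu, u⟩`
cannot increase because `c ≥ 0`; then `N → ∞`.

The Bessel formula compares power series. The Beta kernel comes from the substitution `x = w²` and
evenness. The representation in `L²` follows by testing against `g` and Fubini, and its pointwise
form by testing against indicators. -/

noncomputable section

namespace FracEPD

open Filter Topology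

/-! ### Real Fourier multipliers on `L²` -/

section Multiplier

variable {α : Type*} [MeasurableSpace α] {ν : Measure α}

/-- The product `m F` of an `L²` function with a real multiplier (zero if it is not in `L²`). -/
def mulL2 (m : α → ℝ) (F : Lp ℂ 2 ν) : Lp ℂ 2 ν :=
  open Classical in
  if h : MemLp (fun a => (m a : ℂ) * F a) 2 ν then h.toLp _ else 0

lemma coeFn_mulL2 {m : α → ℝ} {F : Lp ℂ 2 ν} (h : MemLp (fun a => (m a : ℂ) * F a) 2 ν) :
    mulL2 m F =ᵐ[ν] fun a => (m a : ℂ) * F a := by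
  rw [mulL2, dif_pos h]
  exact h.coeFn_toLp

lemma memLp_mul_of_le {m k : α → ℝ} {F : Lp ℂ 2 ν} (hm : Measurable m)
    (hk : MemLp (fun a => (k a : ℂ) * F a) 2 ν) (hmk : ∀ a, |m a| ≤ k a) :
    MemLp (fun a => (m a : ℂ) * F a) 2 ν := by
  refine hk.of_le ?_ (ae_of_all _ fun a => ?_)
  · exact (Complex.measurable_ofReal.comp hm).aestronglyMeasurable.mul (Lp.aestronglyMeasurable F)
  · rw [norm_mul, norm_mul, Complex.norm_real, Complex.norm_real, Real.norm_eq_abs,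
      Real.norm_eq_abs]
    exact mul_le_mul_of_nonneg_right ((hmk a).trans (le_abs_self _)) (norm_nonneg _)

lemma memLp_mul_of_bounded {m : α → ℝ} {F : Lp ℂ 2 ν} {C : ℝ} (hm : Measurable m)
    (hC : ∀ a, |m a| ≤ C) : MemLp (fun a => (m a : ℂ) * F a) 2 ν :=
  memLp_mul_of_le (k := fun _ => C) hm ((Lp.memLp F).const_mul _) hC

lemma mulL2_one (F : Lp ℂ 2 ν) : mulL2 (fun _ => 1) F = F := by
  have h : MemLp (fun a => (((1 : ℝ)) : ℂ) * F a) 2 ν := (Lp.memLp F).const_mul _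
  refine Lp.ext ((coeFn_mulL2 h).trans (ae_of_all _ fun a => ?_))
  simp

lemma mulL2_zero (F : Lp ℂ 2 ν) : mulL2 (fun _ => 0) F = 0 := by
  have h : MemLp (fun a => (((0 : ℝ)) : ℂ) * F a) 2 ν := (Lp.memLp F).const_mul _
  refine Lp.ext ((coeFn_mulL2 h).trans ?_)
  filter_upwards [Lp.coeFn_zero ℂ 2 ν] with a ha
  rw [ha, Complex.ofReal_zero, zero_mul, Pi.zero_apply]

/-- Dominated convergence for the squared difference, with majorant `|2kF|²`. The general filter
lets it serve both continuity in time and limits of difference quotients. -/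
lemma tendsto_mulL2 {ι : Type*} {l : Filter ι} [l.IsCountablyGenerated] {m : ι → α → ℝ}
    {m₀ k : α → ℝ} {F : Lp ℂ 2 ν} (hm : ∀ i, Measurable (m i)) (hm₀ : Measurable m₀)
    (hk : MemLp (fun a => (k a : ℂ) * F a) 2 ν) (hmk : ∀ i a, |m i a| ≤ k a)
    (hmk₀ : ∀ a, |m₀ a| ≤ k a)
    (hlim : ∀ a, Tendsto (fun i => m i a) l (𝓝 (m₀ a))) :
    Tendsto (fun i => mulL2 (m i) F) l (𝓝 (mulL2 m₀ F)) := by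
  rw [Lp.tendsto_Lp_iff_tendsto_eLpNorm']
  have h1 : ∀ i, eLpNorm (⇑(mulL2 (m i) F) - ⇑(mulL2 m₀ F)) 2 ν =
      (∫⁻ a, ‖((m i a : ℂ) - m₀ a) * F a‖ₑ ^ (2 : ℝ) ∂ν) ^ (1 / (2 : ℝ)) := by
    intro i
    have h2 : (⇑(mulL2 (m i) F) - ⇑(mulL2 m₀ F)) =ᵐ[ν] fun a => ((m i a : ℂ) - m₀ a) * F a := by
      filter_upwards [coeFn_mulL2 (memLp_mul_of_le (hm i) hk (hmk i)),
        coeFn_mulL2 (memLp_mul_of_le hm₀ hk hmk₀)] with a ha hb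
      rw [Pi.sub_apply, ha, hb, sub_mul]
    rw [eLpNorm_congr_ae h2, eLpNorm_eq_lintegral_rpow_enorm_toReal (by norm_num) (by norm_num)]
    rfl
  simp_rw [h1]
  have hFm := (Lp.aestronglyMeasurable F).aemeasurable
  have h3 : Tendsto (fun i => ∫⁻ a, ‖((m i a : ℂ) - m₀ a) * F a‖ₑ ^ (2 : ℝ) ∂ν) l
      (𝓝 (∫⁻ _, 0 ∂ν)) := by
    refine tendsto_lintegral_filter_of_dominated_convergence'
      (fun a => ‖(2 : ℂ) * ((k a : ℂ) * F a)‖ₑ ^ (2 : ℝ)) ?_ ?_ ?_ ?_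
    · refine Eventually.of_forall fun i => ?_
      have : Measurable fun a => (m i a : ℂ) - m₀ a :=
        (Complex.measurable_ofReal.comp (hm i)).sub (Complex.measurable_ofReal.comp hm₀)
      exact ((this.aemeasurable.mul hFm).enorm).pow_const _
    · refine Eventually.of_forall fun i => ae_of_all _ fun a => ?_
      refine ENNReal.rpow_le_rpow ?_ (by norm_num)
      rw [← mul_assoc, enorm_mul, enorm_mul]
      gcongr
      rw [← ofReal_norm, ← ofReal_norm]
      refine ENNReal.ofReal_le_ofReal ?_
      rw [← Complex.ofReal_sub, Complex.norm_real, norm_mul, Complex.norm_real, Complex.norm_ofNat,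
        Real.norm_eq_abs, Real.norm_eq_abs]
      have := abs_sub (m i a) (m₀ a)
      linarith [hmk i a, hmk₀ a, le_abs_self (k a)]
    · have := (hk.const_mul (2 : ℂ)).eLpNorm_lt_top
      rw [eLpNorm_eq_lintegral_rpow_enorm_toReal (by norm_num) (by norm_num)] at this
      have h4 := (ENNReal.rpow_lt_top_iff_of_pos (by norm_num)).1 this
      exact h4.ne
    · refine ae_of_all _ fun a => ?_
      have h5 : Tendsto (fun i => ((m i a : ℂ) - m₀ a) * F a) l (𝓝 0) := by
        have := (((Complex.continuous_ofReal.tendsto _).comp (hlim a)).sub_const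
          (m₀ a : ℂ)).mul_const (F a)
        simpa using this
      have h6 := (ENNReal.continuous_rpow_const (y := 2)).tendsto _ |>.comp h5.enorm
      simpa [Function.comp_def] using h6
  have h7 := (ENNReal.continuous_rpow_const (y := 1 / (2 : ℝ))).tendsto _ |>.comp h3
  simpa [Function.comp_def] using h7

lemma continuous_mulL2 {G : ℝ → α → ℝ} {k : α → ℝ} {F : Lp ℂ 2 ν} (hG : ∀ t, Measurable (G t))
    (hk : MemLp (fun a => (k a : ℂ) * F a) 2 ν) (hGk : ∀ t a, |G t a| ≤ k a)
    (hcont : ∀ a, Continuous fun t => G t a) : Continuous fun t => mulL2 (G t) F :=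
  continuous_iff_continuousAt.2 fun t =>
    tendsto_mulL2 hG (hG t) hk hGk (hGk t) fun a => (hcont a).tendsto t

/-- The mean value inequality bounds the difference quotients of `G` by the same `k` that bounds
`G'`, so `tendsto_mulL2` applies to them. -/
lemma hasDerivAt_mulL2 {G G' : ℝ → α → ℝ} {k : α → ℝ} {F : Lp ℂ 2 ν}
    (hG : ∀ t, Measurable (G t)) (hG' : ∀ t, Measurable (G' t))
    (hk : MemLp (fun a => (k a : ℂ) * F a) 2 ν) (hGk : ∀ t a, |G' t a| ≤ k a)
    (hGF : ∀ t, MemLp (fun a => (G t a : ℂ) * F a) 2 ν)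
    (hderiv : ∀ t a, HasDerivAt (fun s => G s a) (G' t a) t) (t : ℝ) :
    HasDerivAt (fun s => mulL2 (G s) F) (mulL2 (G' t) F) t := by
  have hk0 : ∀ a, 0 ≤ k a := fun a => (abs_nonneg _).trans (hGk t a)
  have hlip : ∀ s a, |G s a - G t a| ≤ k a * |s - t| := fun s a => by
    have := convex_univ.norm_image_sub_le_of_norm_hasDerivWithin_le (f := fun s => G s a)
      (f' := fun s => G' s a) (C := k a) (fun x _ => (hderiv x a).hasDerivWithinAt)
      (fun x _ => hGk x a) (mem_univ t) (mem_univ s)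
    simpa [Real.norm_eq_abs] using this
  have hbd : ∀ s a, |(s - t)⁻¹ * (G s a - G t a)| ≤ k a := fun s a => by
    rcases eq_or_ne s t with rfl | hst
    · simpa using hk0 a
    · have h0 : 0 < |s - t| := abs_pos.2 (sub_ne_zero.2 hst)
      rw [abs_mul, abs_inv, inv_mul_le_iff₀ h0, mul_comm]
      exact hlip s a
  have hmeas : ∀ s, Measurable fun a => (s - t)⁻¹ * (G s a - G t a) := fun s =>
    ((hG s).sub (hG t)).const_mul _
  rw [hasDerivAt_iff_tendsto_slope]
  have hslope : slope (fun s => mulL2 (G s) F) t =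
      fun s => mulL2 (fun a => (s - t)⁻¹ * (G s a - G t a)) F := by
    funext s
    rw [slope_def_module]
    refine Lp.ext ?_
    filter_upwards [Lp.coeFn_smul (s - t)⁻¹ (mulL2 (G s) F - mulL2 (G t) F),
      Lp.coeFn_sub (mulL2 (G s) F) (mulL2 (G t) F), coeFn_mulL2 (hGF s), coeFn_mulL2 (hGF t),
      coeFn_mulL2 (memLp_mul_of_le (hmeas s) hk (hbd s))] with a h1 h2 h3 h4 h5
    rw [h1, Pi.smul_apply, h2, Pi.sub_apply, h3, h4, h5, Complex.real_smul]
    push_cast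
    ring
  rw [hslope]
  refine tendsto_mulL2 hmeas (hG' t) hk hbd (hGk t) fun a => ?_
  have := hasDerivAt_iff_tendsto_slope.1 (hderiv t a)
  refine this.congr fun s => ?_
  rw [slope_def_module, smul_eq_mul]

lemma inner_mulL2 {m : α → ℝ} {F : Lp ℂ 2 ν} (g : Lp ℂ 2 ν)
    (h : MemLp (fun a => (m a : ℂ) * F a) 2 ν) :
    inner ℂ g (mulL2 m F) = ∫ a, (m a : ℂ) * ((starRingEnd ℂ) (g a) * F a) ∂ν := by
  rw [L2.inner_def]
  refine integral_congr_ae ?_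
  filter_upwards [coeFn_mulL2 h] with a ha
  rw [ha, RCLike.inner_apply]
  ring

/-- Lets part of a multiplier be carried by the test function, which saves one power of the
frequency on `F`. -/
lemma inner_mulL2_eq {m m' m'' : α → ℝ} {F g : Lp ℂ 2 ν}
    (hm : MemLp (fun a => (m a : ℂ) * F a) 2 ν) (hm' : MemLp (fun a => (m' a : ℂ) * g a) 2 ν)
    (hm'' : MemLp (fun a => (m'' a : ℂ) * F a) 2 ν) (hmul : ∀ a, m a = m' a * m'' a) :
    inner ℂ g (mulL2 m F) = inner ℂ (mulL2 m' g) (mulL2 m'' F) := by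
  rw [L2.inner_def, L2.inner_def]
  refine integral_congr_ae ?_
  filter_upwards [coeFn_mulL2 hm, coeFn_mulL2 hm', coeFn_mulL2 hm''] with a h1 h2 h3
  rw [h1, h2, h3, RCLike.inner_apply, RCLike.inner_apply, hmul]
  simp only [map_mul, Complex.conj_ofReal, Complex.ofReal_mul]
  ring

/-- Multiplication by a bounded measurable real function as a bounded operator. -/
def mulCLM (m : α → ℝ) (hm : Measurable m) (C : ℝ) (hC : ∀ a, |m a| ≤ C) :
    Lp ℂ 2 ν →L[ℂ] Lp ℂ 2 ν :=
  LinearMap.mkContinuous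
    { toFun := mulL2 m
      map_add' := fun F G => by
        refine Lp.ext ?_
        filter_upwards [coeFn_mulL2 (memLp_mul_of_bounded (F := F + G) hm hC),
          coeFn_mulL2 (memLp_mul_of_bounded (F := F) hm hC),
          coeFn_mulL2 (memLp_mul_of_bounded (F := G) hm hC), Lp.coeFn_add F G,
          Lp.coeFn_add (mulL2 m F) (mulL2 m G)] with a h1 h2 h3 h4 h5
        rw [h1, h5, Pi.add_apply, h2, h3, h4, Pi.add_apply, mul_add]
      map_smul' := fun c F => by
        refine Lp.ext ?_
        filter_upwards [coeFn_mulL2 (memLp_mul_of_bounded (F := c • F) hm hC),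
          coeFn_mulL2 (memLp_mul_of_bounded (F := F) hm hC), Lp.coeFn_smul c F,
          Lp.coeFn_smul c (mulL2 m F)] with a h1 h2 h3 h4
        rw [h1, RingHom.id_apply, h4, Pi.smul_apply, h2, h3, Pi.smul_apply, smul_eq_mul,
          smul_eq_mul]
        ring } C fun F => by
    refine Lp.norm_le_mul_norm_of_ae_le_mul ?_
    filter_upwards [coeFn_mulL2 (memLp_mul_of_bounded (F := F) hm hC)] with a h1
    change ‖(mulL2 m F : α → ℂ) a‖ ≤ _
    rw [h1, norm_mul, Complex.norm_real, Real.norm_eq_abs]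
    exact mul_le_mul_of_nonneg_right (hC a) (norm_nonneg _)

end Multiplier

/-! ### Energy method for a bounded operator -/

section Energy

variable {H : Type*} [NormedAddCommGroup H] [InnerProductSpace ℂ H]

/-- A weak derivative that is continuous is a derivative in norm. -/
lemma hasDerivAt_of_inner {v w : ℝ → H}
    (hweak : ∀ g : H, ∀ t : ℝ, 0 < t → HasDerivAt (fun s => inner ℂ g (v s)) (inner ℂ g (w t)) t)
    (hw : ContinuousOn w (Ioi 0)) {t : ℝ} (ht : 0 < t) : HasDerivAt v (w t) t := by
  rw [hasDerivAt_iff_isLittleO, Asymptotics.isLittleO_iff]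
  intro ε hε
  have hcw : ContinuousAt w t := hw.continuousAt (Ioi_mem_nhds ht)
  obtain ⟨δ, hδ, hball⟩ := Metric.mem_nhds_iff.1 (inter_mem (Ioi_mem_nhds ht)
    (hcw (Metric.ball_mem_nhds _ hε)))
  filter_upwards [Metric.ball_mem_nhds t hδ] with s hs
  -- Testing with the Taylor remainder itself: the mean value inequality for `r ↦ ⟨g, v r⟩ - r⟨g, w
  -- t⟩` yields `‖g‖² ≤ ‖g‖ ε |s - t|`, and one factor `‖g‖` cancels.
  set g : H := v s - v t - (s - t) • w t with hg
  have hd : ∀ r ∈ Metric.ball t δ, HasDerivWithinAt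
      (fun r => inner ℂ g (v r) - (r : ℂ) * inner ℂ g (w t))
      (inner ℂ g (w r) - inner ℂ g (w t)) (Metric.ball t δ) r := fun r hr => by
    have h1 : HasDerivAt (fun r : ℝ => (r : ℂ) * inner ℂ g (w t)) (1 * inner ℂ g (w t)) r :=
      (HasDerivAt.ofReal_comp (hasDerivAt_id r)).mul_const _
    have h2 := (hweak g r (hball hr).1).sub h1
    rw [one_mul] at h2
    exact h2.hasDerivWithinAt
  have hb : ∀ r ∈ Metric.ball t δ, ‖inner ℂ g (w r) - inner ℂ g (w t)‖ ≤ ‖g‖ * ε := fun r hr => by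
    rw [← inner_sub_right]
    refine (norm_inner_le_norm _ _).trans (mul_le_mul_of_nonneg_left ?_ (norm_nonneg _))
    have := (hball hr).2
    rw [mem_preimage, Metric.mem_ball, dist_eq_norm] at this
    exact this.le
  have hmv := (convex_ball t δ).norm_image_sub_le_of_norm_hasDerivWithin_le hd hb
    (Metric.mem_ball_self hδ) hs
  have heq : inner ℂ g (v s) - (s : ℂ) * inner ℂ g (w t) -
      (inner ℂ g (v t) - (t : ℂ) * inner ℂ g (w t)) = inner ℂ g g := by
    have hexp : ∀ x : H, (inner ℂ x g : ℂ) =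
        inner ℂ x (v s) - inner ℂ x (v t) - ((s - t : ℝ) : ℂ) * inner ℂ x (w t) := fun x => by
      rw [hg, inner_sub_right, inner_sub_right, ← Complex.coe_smul, inner_smul_right]
    rw [hexp g]
    push_cast
    ring
  rw [heq, inner_self_eq_norm_sq_to_K, norm_pow, RCLike.norm_ofReal, abs_norm] at hmv
  rcases (norm_nonneg g).eq_or_lt with h0 | h0
  · rw [← h0]
    positivity
  · nlinarith

/-- The energy method: the Cauchy problem `u'' + c u' + B u = 0` with a bounded nonnegative
symmetric operator `B`, a damping coefficient `c ≥ 0` and zero data has only the zero solution. -/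
lemma eq_zero_of_energy (B : H →L[ℂ] H) (hsymm : ∀ x y, inner ℂ (B x) y = inner ℂ x (B y))
    (hpos : ∀ x, 0 ≤ (inner ℂ (B x) x).re) {c : ℝ → ℝ} (hc : ContinuousOn c (Ioi 0))
    (hc0 : ∀ t, 0 < t → 0 ≤ c t) {u v : ℝ → H}
    (hu : ∀ t, 0 ≤ t → HasDerivWithinAt u (v t) (Ici 0) t) (hv : ContinuousOn v (Ici 0))
    (hu0 : u 0 = 0) (hv0 : v 0 = 0)
    (hweak : ∀ g : H, ∀ t : ℝ, 0 < t → HasDerivAt (fun s => inner ℂ g (v s))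
      (-((c t : ℂ) * inner ℂ g (v t)) - inner ℂ g (B (u t))) t) :
    ∀ t, 0 ≤ t → u t = 0 := by
  have hucont : ContinuousOn u (Ici 0) := fun t ht => (hu t ht).continuousWithinAt
  -- As `B` is bounded, the right side is norm continuous on `t > 0`, so the weak equation holds in
  -- norm and the energy may be differentiated.
  have hstrong : ∀ t, 0 < t → HasDerivAt v (-((c t : ℂ) • v t) - B (u t)) t := fun t ht => by
    refine hasDerivAt_of_inner (w := fun t => -((c t : ℂ) • v t) - B (u t)) (fun g t ht => ?_) ?_ ht
    · simpa only [inner_sub_right, inner_neg_right, inner_smul_right] using hweak g t ht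
    · have h1 := hv.mono Ioi_subset_Ici_self
      have h2 := hucont.mono Ioi_subset_Ici_self
      exact (((Complex.continuous_ofReal.comp_continuousOn hc).smul h1).neg).sub
        (B.continuous.comp_continuousOn h2)
  set E : ℝ → ℝ := fun t => (inner ℂ (v t) (v t)).re + (inner ℂ (B (u t)) (u t)).re with hE
  have hEcont : ContinuousOn E (Ici 0) := by
    refine ContinuousOn.add (Complex.continuous_re.comp_continuousOn (hv.inner hv))
      (Complex.continuous_re.comp_continuousOn ?_)
    exact (B.continuous.comp_continuousOn hucont).inner hucont
  have hEd : ∀ t, 0 < t → HasDerivAt E (-2 * c t * ‖v t‖ ^ 2) t := fun t ht => by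
    have hu' : HasDerivAt u (v t) t := (hu t ht.le).hasDerivAt (Ici_mem_nhds ht)
    have hv' := hstrong t ht
    have h1 := (hv'.inner ℂ hv')
    have hB : HasDerivAt (fun s => B (u s)) (B (v t)) t :=
      (B.restrictScalars ℝ).hasFDerivAt.comp_hasDerivAt t hu'
    have h2 := hB.inner ℂ hu'
    have h3 := Complex.reCLM.hasFDerivAt.comp_hasDerivAt t h1
    have h4 := Complex.reCLM.hasFDerivAt.comp_hasDerivAt t h2
    refine (h3.add h4).congr_deriv ?_
    have e1 : (inner ℂ (v t) (v t) : ℂ).re = ‖v t‖ ^ 2 := by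
      rw [← RCLike.re_to_complex, inner_self_eq_norm_sq]
    have e2 : (inner ℂ (B (v t)) (u t) : ℂ) = inner ℂ (v t) (B (u t)) := hsymm _ _
    have e3 : (inner ℂ (B (u t)) (v t) : ℂ).re = (inner ℂ (v t) (B (u t)) : ℂ).re := by
      rw [← inner_conj_symm, Complex.conj_re]
    simp only [Complex.reCLM_apply, inner_sub_right, inner_sub_left, inner_neg_right,
      inner_neg_left, inner_smul_right, inner_smul_left, Complex.conj_ofReal, Complex.add_re,
      Complex.sub_re, Complex.neg_re, Complex.re_ofReal_mul, e1, e2, e3]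
    ring
  -- Only continuity of `E` is needed at `0`, so a singularity of `c` there is harmless.
  have hanti : AntitoneOn E (Ici 0) := by
    refine antitoneOn_of_deriv_nonpos (convex_Ici 0) hEcont ?_ ?_
    · rw [interior_Ici]
      exact fun t ht => (hEd t ht).differentiableAt.differentiableWithinAt
    · rw [interior_Ici]
      intro t ht
      rw [(hEd t ht).deriv]
      nlinarith [hc0 t ht, mul_nonneg (hc0 t ht) (sq_nonneg ‖v t‖)]
  have hvz : ∀ t, 0 ≤ t → v t = 0 := fun t ht => by
    have h1 := hanti (mem_Ici.2 le_rfl) (mem_Ici.2 ht) ht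
    simp only [hE, hu0, hv0, map_zero, inner_zero_left, Complex.zero_re, add_zero] at h1
    have h2 := hpos (u t)
    have e1 : (inner ℂ (v t) (v t) : ℂ).re = ‖v t‖ ^ 2 := by
      rw [← RCLike.re_to_complex, inner_self_eq_norm_sq]
    rw [e1] at h1
    have : ‖v t‖ ^ 2 = 0 := le_antisymm (by linarith) (sq_nonneg _)
    exact norm_eq_zero.1 (pow_eq_zero_iff (by norm_num) |>.1 this)
  intro t ht
  have := (convex_Ici (0 : ℝ)).norm_image_sub_le_of_norm_hasDerivWithin_le (C := 0)
    (fun x hx => hu x hx) (fun x hx => by rw [hvz x hx, norm_zero]) (mem_Ici.2 le_rfl) (mem_Ici.2 ht)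
  rw [hu0, sub_zero, zero_mul] at this
  exact norm_le_zero_iff.1 this

end Energy

/-- `φ` with derivatives `φ₁`, `φ₂` solves `φ'' + (a/z) φ' + φ = 0`, `φ(0) = 1`, `φ'(0) = 0`, and
all three functions are bounded by one. -/
structure IsProfile (a : ℝ) (φ φ₁ φ₂ : ℝ → ℝ) : Prop where
  deriv₀ : ∀ z, HasDerivAt φ (φ₁ z) z
  deriv₁ : ∀ z, HasDerivAt φ₁ (φ₂ z) z
  cont₂ : Continuous φ₂
  bound₀ : ∀ z, |φ z| ≤ 1
  bound₁ : ∀ z, |φ₁ z| ≤ 1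
  bound₂ : ∀ z, |φ₂ z| ≤ 1
  zero₀ : φ 0 = 1
  zero₁ : φ₁ 0 = 0
  ode : ∀ z, z * φ₂ z + a * φ₁ z + z * φ z = 0

lemma isProfile_cos : IsProfile 0 Real.cos (fun z => -Real.sin z) (fun z => -Real.cos z) where
  deriv₀ := Real.hasDerivAt_cos
  deriv₁ z := (Real.hasDerivAt_sin z).neg
  cont₂ := Real.continuous_cos.neg
  bound₀ := Real.abs_cos_le_one
  bound₁ z := by rw [abs_neg]; exact Real.abs_sin_le_one z
  bound₂ z := by rw [abs_neg]; exact Real.abs_cos_le_one z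
  zero₀ := Real.cos_zero
  zero₁ := by simp
  ode z := by ring

/-! ### Moments of the Beta distribution -/

section Moments

/-- The moments of the Beta distribution with parameters `1/2` and `lam`. -/
def betaMoment (lam : ℝ) (k : ℕ) : ℝ := beta (1 / 2 + k) lam / beta (1 / 2) lam

variable {lam : ℝ}

lemma measurable_betaPDF (a b : ℝ) : Measurable (betaPDF a b) :=
  (measurable_betaPDFReal a b).ennreal_ofReal

lemma ae_betaMeasure_mem_Ioo (a b : ℝ) : ∀ᵐ x ∂(betaMeasure a b), x ∈ Ioo (0 : ℝ) 1 := by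
  rw [betaMeasure, ae_withDensity_iff (measurable_betaPDF a b)]
  refine ae_of_all _ fun x hx => ?_
  by_contra h
  refine hx ?_
  rw [betaPDF_eq, if_neg (show ¬(0 < x ∧ x < 1) from h), ENNReal.ofReal_zero]

lemma betaPDFReal_nonneg {a b : ℝ} (ha : 0 < a) (hb : 0 < b) (x : ℝ) : 0 ≤ betaPDFReal a b x := by
  by_cases h : 0 < x ∧ x < 1
  · exact (betaPDFReal_pos h.1 h.2 ha hb).le
  · rw [betaPDFReal, if_neg h]

lemma integral_betaMeasure {E : Type*} [NormedAddCommGroup E] [NormedSpace ℝ E] {a b : ℝ}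
    (ha : 0 < a) (hb : 0 < b) (g : ℝ → E) :
    ∫ x, g x ∂(betaMeasure a b) = ∫ x, betaPDFReal a b x • g x := by
  rw [betaMeasure, integral_withDensity_eq_integral_toReal_smul
    (measurable_betaPDF a b) (ae_of_all _ fun x => ENNReal.ofReal_lt_top)]
  refine integral_congr_ae (ae_of_all _ fun x => ?_)
  simp only [betaPDF, ENNReal.toReal_ofReal (betaPDFReal_nonneg ha hb x)]

lemma integral_betaPDFReal {a b : ℝ} (ha : 0 < a) (hb : 0 < b) :
    ∫ x, betaPDFReal a b x = 1 := by
  have := isProbabilityMeasureBeta ha hb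
  have h := integral_betaMeasure ha hb (fun _ => (1 : ℝ))
  simpa using h.symm

/-- Multiplying the density by `x^k` shifts its first parameter by `k`; what remains is the ratio of
the normalising constants. -/
lemma integral_pow_betaMeasure (hlam : 0 < lam) (k : ℕ) :
    ∫ x, x ^ k ∂(betaMeasure (1 / 2) lam) = betaMoment lam k := by
  have hk : (0 : ℝ) < 1 / 2 + k := by positivity
  have hb := beta_pos (α := 1 / 2) (β := lam) (by norm_num) hlam
  have hbk := (beta_pos hk hlam).ne'
  rw [integral_betaMeasure (by norm_num) hlam]
  have h : ∀ x, betaPDFReal (1 / 2) lam x • x ^ k =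
      betaMoment lam k * betaPDFReal (1 / 2 + k) lam x := fun x => by
    by_cases hx : 0 < x ∧ x < 1
    · rw [betaPDFReal, betaPDFReal, if_pos hx, if_pos hx, betaMoment,
        show (1 / 2 + k - 1 : ℝ) = (1 / 2 - 1) + k by ring, Real.rpow_add hx.1,
        Real.rpow_natCast, smul_eq_mul]
      generalize beta (1 / 2 + k) lam = b at *
      field_simp
    · rw [betaPDFReal, betaPDFReal, if_neg hx, if_neg hx, zero_smul, mul_zero]
  simp_rw [h]
  rw [integral_const_mul, integral_betaPDFReal hk hlam, mul_one]

lemma betaMoment_zero (hlam : 0 < lam) : betaMoment lam 0 = 1 := by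
  have hb := beta_pos (α := 1 / 2) (β := lam) (by norm_num) hlam
  rw [betaMoment, Nat.cast_zero, add_zero, div_self hb.ne']

lemma betaMoment_succ (hlam : 0 < lam) (k : ℕ) :
    betaMoment lam (k + 1) * (1 / 2 + k + lam) = betaMoment lam k * (1 / 2 + k) := by
  have hk : (0 : ℝ) < 1 / 2 + k := by positivity
  have hkl : (0 : ℝ) < 1 / 2 + k + lam := by positivity
  have hb := beta_pos (α := 1 / 2) (β := lam) (by norm_num) hlam
  have hG := Real.Gamma_pos_of_pos hkl
  have h1 : beta (1 / 2 + (k + 1 : ℕ)) lam * (1 / 2 + k + lam) =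
      beta (1 / 2 + k) lam * (1 / 2 + k) := by
    rw [beta, beta, Nat.cast_add, Nat.cast_one, show (1 / 2 + (k + 1) : ℝ) = 1 / 2 + k + 1 by ring,
      show (1 / 2 + k + 1 + lam : ℝ) = 1 / 2 + k + lam + 1 by ring, Real.Gamma_add_one hk.ne',
      Real.Gamma_add_one hkl.ne']
    field_simp
  rw [betaMoment, betaMoment, div_mul_eq_mul_div, h1, div_mul_eq_mul_div]

end Moments

/-! ### The EPD profile, its series and its differential equation -/

section Profile

variable {lam : ℝ}

/-- `E cos(z √X)` for `X` with the Beta distribution with parameters `1/2` and `lam`. -/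
def epdProfile (lam z : ℝ) : ℝ := ∫ x, Real.cos (z * √x) ∂(betaMeasure (1 / 2) lam)

/-- The derivative of `epdProfile`. -/
def epdProfile₁ (lam z : ℝ) : ℝ := ∫ x, -(√x * Real.sin (z * √x)) ∂(betaMeasure (1 / 2) lam)

/-- The second derivative of `epdProfile`. -/
def epdProfile₂ (lam z : ℝ) : ℝ := ∫ x, -(x * Real.cos (z * √x)) ∂(betaMeasure (1 / 2) lam)

lemma abs_integral_le_one {Ω : Type*} [MeasurableSpace Ω] (P : Measure Ω)
    [IsProbabilityMeasure P] {f : Ω → ℝ} (hf : ∀ᵐ x ∂P, |f x| ≤ 1) : |∫ x, f x ∂P| ≤ 1 := by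
  rw [← Real.norm_eq_abs]
  exact (norm_integral_le_of_norm_le_const (C := 1) hf).trans (by simp)

lemma ae_sqrt_bounds (a b : ℝ) :
    ∀ᵐ x ∂(betaMeasure a b), 0 ≤ √x ∧ √x ≤ 1 ∧ √x * √x = x ∧ 0 ≤ x ∧ x ≤ 1 := by
  filter_upwards [ae_betaMeasure_mem_Ioo a b] with x hx
  exact ⟨Real.sqrt_nonneg x, Real.sqrt_le_one.2 hx.2.le, Real.mul_self_sqrt hx.1.le, hx.1.le,
    hx.2.le⟩

lemma abs_mul_le_one {a b : ℝ} (ha : 0 ≤ a) (ha' : a ≤ 1) (hb : |b| ≤ 1) : |a * b| ≤ 1 := by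
  rw [abs_mul, abs_of_nonneg ha]
  exact mul_le_one₀ ha' (abs_nonneg _) hb

lemma hasDerivAt_epdProfile (hlam : 0 < lam) (z : ℝ) :
    HasDerivAt (epdProfile lam) (epdProfile₁ lam z) z := by
  have := isProbabilityMeasureBeta (α := 1 / 2) (by norm_num) hlam
  refine (hasDerivAt_integral_of_dominated_loc_of_deriv_le (μ := betaMeasure (1 / 2) lam)
    (F := fun z x => Real.cos (z * √x)) (F' := fun z x => -(√x * Real.sin (z * √x)))
    (bound := fun _ => 1) univ_mem ?_ ?_ ?_ ?_ (integrable_const _) ?_).2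
  · exact Eventually.of_forall fun z => (by fun_prop : Measurable _).aestronglyMeasurable
  · exact Integrable.of_bound (C := 1) (by fun_prop : Measurable _).aestronglyMeasurable
      (ae_of_all _ fun x => Real.abs_cos_le_one _)
  · exact (by fun_prop : Measurable _).aestronglyMeasurable
  · filter_upwards [ae_sqrt_bounds (1 / 2) lam] with x hx z _
    rw [norm_neg]
    exact abs_mul_le_one hx.1 hx.2.1 (Real.abs_sin_le_one _)
  · refine ae_of_all _ fun x z _ => ?_
    have := (Real.hasDerivAt_cos (z * √x)).comp z ((hasDerivAt_id z).mul_const √x)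
    refine this.congr_deriv ?_
    ring

lemma hasDerivAt_epdProfile₁ (hlam : 0 < lam) (z : ℝ) :
    HasDerivAt (epdProfile₁ lam) (epdProfile₂ lam z) z := by
  have := isProbabilityMeasureBeta (α := 1 / 2) (by norm_num) hlam
  have h := (hasDerivAt_integral_of_dominated_loc_of_deriv_le (μ := betaMeasure (1 / 2) lam)
    (F := fun z x => -(√x * Real.sin (z * √x))) (F' := fun z x => -(√x * √x * Real.cos (z * √x)))
    (x₀ := z) (bound := fun _ => 1) univ_mem ?_ ?_ ?_ ?_ (integrable_const _) ?_).2
  · refine h.congr_deriv (integral_congr_ae ?_)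
    filter_upwards [ae_sqrt_bounds (1 / 2) lam] with x hx
    simp only [hx.2.2.1]
  · exact Eventually.of_forall fun z => (by fun_prop : Measurable _).aestronglyMeasurable
  · refine Integrable.of_bound (C := 1) (by fun_prop : Measurable _).aestronglyMeasurable ?_
    filter_upwards [ae_sqrt_bounds (1 / 2) lam] with x hx
    rw [norm_neg]
    exact abs_mul_le_one hx.1 hx.2.1 (Real.abs_sin_le_one _)
  · exact (by fun_prop : Measurable _).aestronglyMeasurable
  · filter_upwards [ae_sqrt_bounds (1 / 2) lam] with x hx z _
    rw [norm_neg, hx.2.2.1]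
    exact abs_mul_le_one hx.2.2.2.1 hx.2.2.2.2 (Real.abs_cos_le_one _)
  · refine ae_of_all _ fun x z _ => ?_
    have := (((Real.hasDerivAt_sin (z * √x)).comp z
      ((hasDerivAt_id z).mul_const √x)).const_mul √x).neg
    refine this.congr_deriv ?_
    ring

lemma continuous_epdProfile₂ (hlam : 0 < lam) : Continuous (epdProfile₂ lam) := by
  have := isProbabilityMeasureBeta (α := 1 / 2) (by norm_num) hlam
  refine continuous_of_dominated (bound := fun _ => 1)
    (fun z => (by fun_prop : Measurable _).aestronglyMeasurable) (fun z => ?_)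
    (integrable_const _) (ae_of_all _ fun x => by fun_prop)
  filter_upwards [ae_sqrt_bounds (1 / 2) lam] with x hx
  rw [norm_neg]
  exact abs_mul_le_one hx.2.2.2.1 hx.2.2.2.2 (Real.abs_cos_le_one _)

/-- Termwise integration of a power series with absolutely summable terms. -/
lemma hasSum_integral_series {Ω : Type*} [MeasurableSpace Ω] {P : Measure Ω}
    [IsProbabilityMeasure P] {b : ℕ → ℝ} {g : ℕ → Ω → ℝ} {f : Ω → ℝ} (hg : ∀ k, Measurable (g k))
    (hbd : ∀ k, ∀ᵐ x ∂P, |g k x| ≤ b k) (hb : Summable b)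
    (hsum : ∀ᵐ x ∂P, HasSum (fun k => g k x) (f x)) :
    HasSum (fun k => ∫ x, g k x ∂P) (∫ x, f x ∂P) :=
  hasSum_integral_of_dominated_convergence (fun k _ => b k)
    (fun k => (hg k).aestronglyMeasurable) hbd (ae_of_all _ fun _ => hb) (integrable_const _) hsum

lemma hasSum_epdProfile (hlam : 0 < lam) (z : ℝ) :
    HasSum (fun k : ℕ => (-1) ^ k * z ^ (2 * k) / ((2 * k).factorial : ℝ) * betaMoment lam k)
      (epdProfile lam z) := by
  have := isProbabilityMeasureBeta (α := 1 / 2) (by norm_num) hlam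
  have h := hasSum_integral_series (P := betaMeasure (1 / 2) lam)
    (b := fun k => |z| ^ (2 * k) / ((2 * k).factorial : ℝ))
    (g := fun k x => (-1) ^ k * z ^ (2 * k) / ((2 * k).factorial : ℝ) * x ^ k)
    (f := fun x => Real.cos (z * √x)) (fun k => by fun_prop) ?_ ?_ ?_
  · simp only [integral_const_mul, integral_pow_betaMeasure hlam] at h
    exact h
  · intro k
    filter_upwards [ae_sqrt_bounds (1 / 2) lam] with x hx
    rw [abs_mul, abs_div, abs_mul, abs_pow, abs_neg, abs_one, one_pow, one_mul, abs_pow,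
      abs_pow, abs_of_nonneg hx.2.2.2.1, Nat.abs_cast]
    exact mul_le_of_le_one_right (by positivity) (pow_le_one₀ hx.2.2.2.1 hx.2.2.2.2)
  · exact (Real.hasSum_cosh |z|).summable
  · filter_upwards [ae_sqrt_bounds (1 / 2) lam] with x hx
    refine (Real.hasSum_cos (z * √x)).congr_fun fun k => ?_
    rw [mul_pow, pow_mul √x, sq, hx.2.2.1]
    ring

lemma hasSum_epdProfile₁ (hlam : 0 < lam) (z : ℝ) :
    HasSum (fun k : ℕ => -((-1) ^ k * z ^ (2 * k + 1) / ((2 * k + 1).factorial : ℝ) *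
      betaMoment lam (k + 1))) (epdProfile₁ lam z) := by
  have := isProbabilityMeasureBeta (α := 1 / 2) (by norm_num) hlam
  have h := hasSum_integral_series (P := betaMeasure (1 / 2) lam)
    (b := fun k => |z| ^ (2 * k + 1) / ((2 * k + 1).factorial : ℝ))
    (g := fun k x => -((-1) ^ k * z ^ (2 * k + 1) / ((2 * k + 1).factorial : ℝ) * x ^ (k + 1)))
    (f := fun x => -(√x * Real.sin (z * √x))) (fun k => by fun_prop) ?_ ?_ ?_
  · rw [epdProfile₁]
    simpa only [integral_neg, integral_const_mul, integral_pow_betaMeasure hlam] using h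
  · intro k
    filter_upwards [ae_sqrt_bounds (1 / 2) lam] with x hx
    rw [abs_neg, abs_mul, abs_div, abs_mul, abs_pow, abs_neg, abs_one, one_pow, one_mul, abs_pow,
      abs_pow, abs_of_nonneg hx.2.2.2.1, Nat.abs_cast]
    exact mul_le_of_le_one_right (by positivity) (pow_le_one₀ hx.2.2.2.1 hx.2.2.2.2)
  · exact (Real.hasSum_sinh |z|).summable
  · filter_upwards [ae_sqrt_bounds (1 / 2) lam] with x hx
    refine (((Real.hasSum_sin (z * √x)).mul_left √x).neg).congr_fun fun k => ?_
    have : x ^ (k + 1) = √x * √x ^ (2 * k + 1) := by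
      conv_lhs => rw [← hx.2.2.1]
      ring
    rw [mul_pow, this]
    ring

lemma hasSum_epdProfile₂ (hlam : 0 < lam) (z : ℝ) :
    HasSum (fun k : ℕ => -((-1) ^ k * z ^ (2 * k) / ((2 * k).factorial : ℝ) *
      betaMoment lam (k + 1))) (epdProfile₂ lam z) := by
  have := isProbabilityMeasureBeta (α := 1 / 2) (by norm_num) hlam
  have h := hasSum_integral_series (P := betaMeasure (1 / 2) lam)
    (b := fun k => |z| ^ (2 * k) / ((2 * k).factorial : ℝ))
    (g := fun k x => -((-1) ^ k * z ^ (2 * k) / ((2 * k).factorial : ℝ) * x ^ (k + 1)))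
    (f := fun x => -(x * Real.cos (z * √x))) (fun k => by fun_prop) ?_ ?_ ?_
  · rw [epdProfile₂]
    simpa only [integral_neg, integral_const_mul, integral_pow_betaMeasure hlam] using h
  · intro k
    filter_upwards [ae_sqrt_bounds (1 / 2) lam] with x hx
    rw [abs_neg, abs_mul, abs_div, abs_mul, abs_pow, abs_neg, abs_one, one_pow, one_mul, abs_pow,
      abs_pow, abs_of_nonneg hx.2.2.2.1, Nat.abs_cast]
    exact mul_le_of_le_one_right (by positivity) (pow_le_one₀ hx.2.2.2.1 hx.2.2.2.2)
  · exact (Real.hasSum_cosh |z|).summable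
  · filter_upwards [ae_sqrt_bounds (1 / 2) lam] with x hx
    refine (((Real.hasSum_cos (z * √x)).mul_left x).neg).congr_fun fun k => ?_
    rw [mul_pow, pow_mul √x, sq, hx.2.2.1]
    ring

/-- All three series run over `z^(2k+1)`. After multiplication by `(2k+1)!` and up to sign, the
coefficient is `(2k+1) m_k - (2k+1+2λ) m_{k+1}`, which vanishes by `betaMoment_succ`. -/
lemma epdProfile_ode (hlam : 0 < lam) (z : ℝ) :
    z * epdProfile₂ lam z + 2 * lam * epdProfile₁ lam z + z * epdProfile lam z = 0 := by
  have h := (((hasSum_epdProfile₂ hlam z).mul_left z).add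
    ((hasSum_epdProfile₁ hlam z).mul_left (2 * lam))).add ((hasSum_epdProfile hlam z).mul_left z)
  refine h.unique ?_
  refine hasSum_zero.congr_fun fun k => ?_
  have hM := betaMoment_succ hlam k
  have hM' : betaMoment lam k = betaMoment lam (k + 1) * (1 / 2 + k + lam) / (1 / 2 + k) := by
    rw [hM]
    field_simp
  rw [hM', Nat.factorial_succ]
  push_cast
  field_simp
  ring

lemma isProfile_epdProfile (hlam : 0 < lam) :
    IsProfile (2 * lam) (epdProfile lam) (epdProfile₁ lam) (epdProfile₂ lam) := by
  have := isProbabilityMeasureBeta (α := 1 / 2) (by norm_num) hlam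
  refine ⟨hasDerivAt_epdProfile hlam, hasDerivAt_epdProfile₁ hlam, continuous_epdProfile₂ hlam,
    fun z => ?_, fun z => ?_, fun z => ?_, ?_, ?_, epdProfile_ode hlam⟩
  · exact abs_integral_le_one _ (ae_of_all _ fun x => Real.abs_cos_le_one _)
  · refine abs_integral_le_one _ ?_
    filter_upwards [ae_sqrt_bounds (1 / 2) lam] with x hx
    rw [abs_neg]
    exact abs_mul_le_one hx.1 hx.2.1 (Real.abs_sin_le_one _)
  · refine abs_integral_le_one _ ?_
    filter_upwards [ae_sqrt_bounds (1 / 2) lam] with x hx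
    rw [abs_neg]
    exact abs_mul_le_one hx.2.2.2.1 hx.2.2.2.2 (Real.abs_cos_le_one _)
  · simp only [epdProfile, zero_mul, Real.cos_zero, integral_const, probReal_univ, smul_eq_mul,
      mul_one]
  · simp [epdProfile₁]

end Profile

/-! ### Identification with the Bessel function -/

section Bessel

variable {lam : ℝ}

/-- Induction on the moment recursion plays the role of the duplication formula: `(2k+2)(2k+1) =
4(k+1)(k+1/2)` accounts for the power of `4`. -/
lemma betaMoment_div_factorial (hlam : 0 < lam) (k : ℕ) :
    betaMoment lam k / ((2 * k).factorial : ℝ) =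
      Real.Gamma (lam + 1 / 2) /
        ((k.factorial : ℝ) * Real.Gamma (lam - 1 / 2 + k + 1) * 4 ^ k) := by
  induction k with
  | zero =>
    have hG := Real.Gamma_pos_of_pos (show 0 < lam + 1 / 2 by linarith)
    rw [betaMoment_zero hlam, Nat.cast_zero, show lam - 1 / 2 + 0 + 1 = lam + 1 / 2 by ring]
    rw [mul_zero, Nat.factorial_zero, Nat.cast_one, pow_zero, one_mul, mul_one, div_one,
      div_self hG.ne']
  | succ k ih =>
    have hp : 0 < lam - 1 / 2 + k + 1 := by
      have : (0 : ℝ) ≤ k := k.cast_nonneg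
      linarith
    have hG := Real.Gamma_pos_of_pos hp
    have hM := betaMoment_succ hlam k
    have h2 : betaMoment lam (k + 1) =
        betaMoment lam k * (1 / 2 + k) / (lam - 1 / 2 + k + 1) := by
      rw [eq_div_iff hp.ne', ← hM]
      ring
    have h3 : betaMoment lam k = Real.Gamma (lam + 1 / 2) /
        ((k.factorial : ℝ) * Real.Gamma (lam - 1 / 2 + k + 1) * 4 ^ k) *
          ((2 * k).factorial : ℝ) := by
      rw [← ih]
      field_simp
    rw [h2, h3, show 2 * (k + 1) = 2 * k + 1 + 1 by ring, Nat.factorial_succ (2 * k + 1),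
      Nat.factorial_succ (2 * k), Nat.factorial_succ k, Nat.cast_add k 1, Nat.cast_one,
      show lam - 1 / 2 + (k + 1 : ℝ) + 1 = lam - 1 / 2 + k + 1 + 1 by ring,
      Real.Gamma_add_one hp.ne', pow_succ]
    generalize lam - 1 / 2 + (k : ℝ) + 1 = p at *
    push_cast
    field_simp
    ring

lemma epdProfile_eq_besselJ (hlam : 0 < lam) {z : ℝ} (hz : 0 < z) :
    epdProfile lam z = (2 / z) ^ (lam - 1 / 2) * Real.Gamma (lam + 1 / 2) *
      besselJ (lam - 1 / 2) z := by
  rw [← (hasSum_epdProfile hlam z).tsum_eq, besselJ, ← tsum_mul_left]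
  refine tsum_congr fun k => ?_
  have hz2 : 0 < z / 2 := by positivity
  have h1 : (2 / z) ^ (lam - 1 / 2) * (z / 2) ^ (lam - 1 / 2) = 1 := by
    rw [← Real.mul_rpow (by positivity) hz2.le, show 2 / z * (z / 2) = 1 by field_simp,
      Real.one_rpow]
  have h2 : (z / 2) ^ (2 * (k : ℝ) + (lam - 1 / 2)) =
      z ^ (2 * k) / 4 ^ k * (z / 2) ^ (lam - 1 / 2) := by
    rw [Real.rpow_add hz2, show (2 * (k : ℝ)) = ((2 * k : ℕ) : ℝ) by push_cast; ring,
      Real.rpow_natCast, div_pow, pow_mul 2]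
    norm_num
  calc _ = (-1) ^ k * z ^ (2 * k) * (betaMoment lam k / ((2 * k).factorial : ℝ)) := by ring
    _ = (-1) ^ k * z ^ (2 * k) * (betaMoment lam k / ((2 * k).factorial : ℝ)) *
        ((2 / z) ^ (lam - 1 / 2) * (z / 2) ^ (lam - 1 / 2)) := by rw [h1, mul_one]
    _ = _ := by
      rw [betaMoment_div_factorial hlam, h2]
      ring

end Bessel

/-! ### The symbol and the change of Fourier convention -/

section Symbol

variable {d : ℕ} {β : ℝ}

/-- The square root of the symbol of `(-Δ)^{β/2}`, in the frequency variable of `𝓕`. -/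
def freq (β : ℝ) (η : Space d) : ℝ := (2 * Real.pi * ‖η‖) ^ (β / 2)

lemma freq_nonneg (η : Space d) : 0 ≤ freq β η := by
  unfold freq
  positivity

lemma measurable_freq : Measurable (freq β : Space d → ℝ) := by
  unfold freq
  fun_prop

lemma freq_dilation (ξ : Space d) : freq β (-((2 * Real.pi)⁻¹ • ξ)) = ‖ξ‖ ^ (β / 2) := by
  have h : 2 * Real.pi * ((2 * Real.pi)⁻¹ * ‖ξ‖) = ‖ξ‖ := by
    have := Real.pi_pos
    field_simp
  rw [freq, norm_neg, norm_smul, Real.norm_of_nonneg (by positivity), h]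

lemma freq_dilation_sq (ξ : Space d) : freq β (-((2 * Real.pi)⁻¹ • ξ)) ^ 2 = ‖ξ‖ ^ β := by
  rw [freq_dilation, ← Real.rpow_natCast, ← Real.rpow_mul (norm_nonneg _)]
  norm_num

lemma dilation_eq (ξ : Space d) : -((2 * Real.pi)⁻¹ • ξ) = (-(2 * Real.pi)⁻¹) • ξ :=
  (neg_smul _ _).symm

lemma dilation_ne_zero : -(2 * Real.pi)⁻¹ ≠ 0 := by
  have := Real.pi_pos
  exact neg_ne_zero.2 (by positivity)

/-- A nonzero dilation scales Lebesgue measure by a constant, so null sets pull back to null sets.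
Hence `hat`, built from a representative, is well defined almost everywhere. -/
lemma ae_comp_smul {r : ℝ} (hr : r ≠ 0) {p : Space d → Prop} (hp : ∀ᵐ η, p η) :
    ∀ᵐ ξ : Space d, p (r • ξ) := by
  have hq : Measure.QuasiMeasurePreserving (fun ξ : Space d => r • ξ) volume volume := by
    refine ⟨measurable_const_smul r, ?_⟩
    rw [Measure.map_addHaar_smul _ hr]
    exact Measure.smul_absolutelyContinuous
  exact hq.ae hp

lemma ae_dilation_iff {p : Space d → Prop} :
    (∀ᵐ ξ : Space d, p (-((2 * Real.pi)⁻¹ • ξ))) ↔ ∀ᵐ η, p η := by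
  simp_rw [dilation_eq]
  refine ⟨fun h => ?_, ae_comp_smul dilation_ne_zero⟩
  filter_upwards [ae_comp_smul (inv_ne_zero dilation_ne_zero) h] with η hη
  rwa [smul_smul, mul_inv_cancel₀ dilation_ne_zero, one_smul] at hη

/-- The summand `1` in the weight is free because `𝓕 f` is already in `L²`. -/
lemma energyDomain_iff {f : L2 d} :
    EnergyDomain β f ↔ MemLp (fun η => (freq β η : ℂ) * (𝓕 f : L2 d) η) 2 := by
  have hm : AEStronglyMeasurable (fun η => (freq β η : ℂ) * (𝓕 f : L2 d) η) :=
    (Complex.measurable_ofReal.comp measurable_freq).aestronglyMeasurable.mul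
      (Lp.aestronglyMeasurable _)
  have hF := (memLp_two_iff_integrable_sq_norm (Lp.aestronglyMeasurable (𝓕 f : L2 d))).1
    (Lp.memLp _)
  rw [memLp_two_iff_integrable_sq_norm hm, EnergyDomain]
  have h1 : (fun ξ : Space d => (1 + ‖ξ‖ ^ β) * ‖hat f ξ‖ ^ 2) = fun ξ =>
      (fun η => (1 + freq β η ^ 2) * ‖(𝓕 f : L2 d) η‖ ^ 2) ((-(2 * Real.pi)⁻¹) • ξ) := by
    funext ξ
    simp only [← dilation_eq, freq_dilation_sq, hat]
  have h2 : ∀ η : Space d, ‖(freq β η : ℂ) * (𝓕 f : L2 d) η‖ ^ 2 =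
      freq β η ^ 2 * ‖(𝓕 f : L2 d) η‖ ^ 2 := fun η => by
    rw [norm_mul, mul_pow, Complex.norm_real, Real.norm_eq_abs, sq_abs]
  rw [h1]
  refine (integrable_comp_smul_iff volume (fun η : Space d =>
    (1 + freq β η ^ 2) * ‖(𝓕 f : L2 d) η‖ ^ 2) dilation_ne_zero).trans ?_
  simp_rw [h2, add_mul, one_mul]
  exact ⟨fun h =>
    (h.sub hF).congr (ae_of_all _ fun η => add_sub_cancel_left _ _), fun h => hF.add h⟩

/-- The Jacobian of the dilation cancels the factor `(2π)^{-d}`. -/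
lemma energyForm_eq (g u : L2 d) :
    energyForm β g u = ∫ η : Space d, ((freq β η ^ 2 : ℝ) : ℂ) *
      ((starRingEnd ℂ) ((𝓕 g : L2 d) η) * (𝓕 u : L2 d) η) := by
  have h1 : (fun ξ : Space d => ((‖ξ‖ ^ β : ℝ) : ℂ) * ((starRingEnd ℂ) (hat g ξ) * hat u ξ)) =
      fun ξ => (fun η => ((freq β η ^ 2 : ℝ) : ℂ) *
        ((starRingEnd ℂ) ((𝓕 g : L2 d) η) * (𝓕 u : L2 d) η)) ((-(2 * Real.pi)⁻¹) • ξ) := by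
    funext ξ
    simp only [← dilation_eq, freq_dilation_sq, hat]
  have hpi := Real.pi_pos
  have h2 := Measure.integral_comp_smul (volume : Measure (Space d)) (fun η : Space d =>
    ((freq β η ^ 2 : ℝ) : ℂ) * ((starRingEnd ℂ) ((𝓕 g : L2 d) η) * (𝓕 u : L2 d) η))
    (-(2 * Real.pi)⁻¹)
  rw [energyForm, h1, h2, finrank_euclideanSpace_fin, ← Complex.coe_smul, smul_eq_mul,
    ← mul_assoc, ← Complex.ofReal_mul,
    abs_inv, abs_pow, abs_neg, abs_inv, abs_of_pos (show 0 < 2 * Real.pi by positivity), inv_pow,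
    inv_inv, inv_mul_cancel₀ (by positivity), Complex.ofReal_one, one_mul]

lemma isFracLaplacian_iff {g h : L2 d} :
    IsFracLaplacian β g h ↔
      (𝓕 h : L2 d) =ᵐ[volume] fun η => ((freq β η ^ 2 : ℝ) : ℂ) * (𝓕 g : L2 d) η := by
  rw [IsFracLaplacian, EventuallyEq, EventuallyEq, ← ae_dilation_iff (p := fun η =>
    (𝓕 h : L2 d) η = ((freq β η ^ 2 : ℝ) : ℂ) * (𝓕 g : L2 d) η)]
  simp only [freq_dilation_sq, hat]

lemma energyForm_eq_inner {g u : L2 d} (hg : EnergyDomain β g) (hu : EnergyDomain β u) :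
    energyForm β g u = inner ℂ (mulL2 (freq β) (𝓕 g : L2 d)) (mulL2 (freq β) (𝓕 u : L2 d)) := by
  rw [energyForm_eq, L2.inner_def]
  refine integral_congr_ae ?_
  filter_upwards [coeFn_mulL2 (energyDomain_iff.1 hg), coeFn_mulL2 (energyDomain_iff.1 hu)]
    with η h1 h2
  rw [h1, h2, RCLike.inner_apply]
  simp only [map_mul, Complex.conj_ofReal, Complex.ofReal_pow]
  ring

lemma energyForm_eq_inner_laplacian {g u h : L2 d} (hh : IsFracLaplacian β u h) :
    energyForm β g u = inner ℂ g h := by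
  rw [energyForm_eq, ← Lp.inner_fourier_eq, L2.inner_def]
  refine integral_congr_ae ?_
  filter_upwards [isFracLaplacian_iff.1 hh] with η h1
  rw [h1, RCLike.inner_apply]
  ring

lemma IsFracLaplacian.memLp {g h : L2 d} (hh : IsFracLaplacian β g h) :
    MemLp (fun η => ((freq β η ^ 2 : ℝ) : ℂ) * (𝓕 g : L2 d) η) 2 :=
  (memLp_congr_ae (isFracLaplacian_iff.1 hh)).1 (Lp.memLp _)

lemma IsFracLaplacian.energyDomain {g h : L2 d} (hh : IsFracLaplacian β g h) :
    EnergyDomain β g := by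
  have h1 : MemLp (fun η => ((1 + freq β η ^ 2 : ℝ) : ℂ) * (𝓕 g : L2 d) η) 2 := by
    refine ((Lp.memLp (𝓕 g : L2 d)).add hh.memLp).ae_eq (ae_of_all _ fun η => ?_)
    rw [Pi.add_apply]
    push_cast
    ring
  refine energyDomain_iff.2 (memLp_mul_of_le measurable_freq h1 fun η => ?_)
  rw [abs_of_nonneg (freq_nonneg η)]
  nlinarith [sq_nonneg (freq β η - 1)]

end Symbol

/-! ### Uniqueness by frequency truncation -/

section Uniqueness

variable {d : ℕ} {β : ℝ} {c : ℝ → ℝ} {f : L2 d}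

/-- The frequencies `η` with `‖2πη‖^{β/2} ≤ N`. -/
def lowFreq (d : ℕ) (β : ℝ) (N : ℕ) : Set (Space d) := {η | freq β η ≤ N}

lemma measurableSet_lowFreq (N : ℕ) : MeasurableSet (lowFreq d β N) :=
  measurableSet_le measurable_freq measurable_const

lemma abs_indicator_lowFreq_le (N n : ℕ) (η : Space d) :
    |(lowFreq d β N).indicator (fun η => freq β η ^ n) η| ≤ (N : ℝ) ^ n := by
  by_cases h : η ∈ lowFreq d β N
  · rw [indicator_of_mem h, abs_pow, abs_of_nonneg (freq_nonneg η)]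
    exact pow_le_pow_left₀ (freq_nonneg η) h n
  · rw [indicator_of_notMem h, abs_zero]
    positivity

/-- Multiplication by the `n`-th power of `freq`, cut off at level `N`. -/
def cutoff (d : ℕ) (β : ℝ) (N n : ℕ) : L2 d →L[ℂ] L2 d :=
  mulCLM ((lowFreq d β N).indicator fun η => freq β η ^ n)
    ((measurable_freq.pow_const n).indicator (measurableSet_lowFreq N)) _
    (abs_indicator_lowFreq_le N n)

lemma coeFn_cutoff (N n : ℕ) (F : L2 d) : cutoff d β N n F =ᵐ[volume] fun η =>
    (((lowFreq d β N).indicator (fun η => freq β η ^ n) η : ℝ) : ℂ) * F η :=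
  coeFn_mulL2 (memLp_mul_of_bounded
    ((measurable_freq.pow_const n).indicator (measurableSet_lowFreq N))
    (abs_indicator_lowFreq_le N n))

lemma inner_cutoff (N n : ℕ) (F G : L2 d) :
    inner ℂ (cutoff d β N n F) G = inner ℂ F (cutoff d β N n G) := by
  rw [L2.inner_def, L2.inner_def]
  refine integral_congr_ae ?_
  filter_upwards [coeFn_cutoff N n F, coeFn_cutoff N n G] with η h1 h2
  rw [h1, h2, RCLike.inner_apply, RCLike.inner_apply]
  simp only [map_mul, Complex.conj_ofReal]
  ring

lemma energyDomain_cutoff (N : ℕ) (F : L2 d) : EnergyDomain β (𝓕⁻ (cutoff d β N 0 F) : L2 d) := by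
  rw [energyDomain_iff, FourierTransform.fourier_fourierInv_eq]
  refine (Lp.memLp (cutoff d β N 1 F)).ae_eq ?_
  filter_upwards [coeFn_cutoff N 1 F, coeFn_cutoff N 0 F] with η h1 h2
  rw [h1, h2]
  by_cases h : η ∈ lowFreq d β N <;> simp [h]

/-- Against truncated test functions the unbounded form becomes that of the bounded operator `cutoff
d β N 2`; this reduces the problem to `eq_zero_of_energy`. -/
lemma energyForm_cutoff (N : ℕ) (G u : L2 d) :
    energyForm β (𝓕⁻ (cutoff d β N 0 G) : L2 d) u =
      inner ℂ G (cutoff d β N 2 (cutoff d β N 0 (𝓕 u : L2 d))) := by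
  rw [energyForm_eq, FourierTransform.fourier_fourierInv_eq, L2.inner_def]
  refine integral_congr_ae ?_
  filter_upwards [coeFn_cutoff N 2 (cutoff d β N 0 (𝓕 u : L2 d)),
    coeFn_cutoff N 0 (𝓕 u : L2 d), coeFn_cutoff N 0 G] with η h1 h2 h3
  rw [h1, h2, h3, RCLike.inner_apply]
  by_cases h : η ∈ lowFreq d β N
  · simp only [indicator_of_mem h, map_mul, pow_zero, Complex.ofReal_one,
      map_one]
    ring
  · simp [h]

lemma inner_cutoff_nonneg (N n : ℕ) (F : L2 d) : 0 ≤ (inner ℂ (cutoff d β N n F) F : ℂ).re := by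
  rw [L2.inner_def]
  have h : ∫ η, inner ℂ (cutoff d β N n F η) (F η) = ((∫ η,
      (lowFreq d β N).indicator (fun η => freq β η ^ n) η * ‖F η‖ ^ 2 : ℝ) : ℂ) := by
    rw [← integral_complex_ofReal]
    refine integral_congr_ae ?_
    filter_upwards [coeFn_cutoff N n F] with η h1
    rw [h1, RCLike.inner_apply]
    simp only [map_mul, Complex.conj_ofReal, Complex.ofReal_mul]
    rw [mul_left_comm, RCLike.mul_conj]
    simp
  rw [h, Complex.ofReal_re]
  refine integral_nonneg fun η => mul_nonneg ?_ (sq_nonneg _)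
  exact indicator_nonneg (fun η _ => pow_nonneg (freq_nonneg η) n) η

/-- `freq` is finite everywhere, so the sets `lowFreq d β N` exhaust the space. -/
lemma eq_zero_of_cutoff {F : L2 d} (h : ∀ N, cutoff d β N 0 F = 0) : F = 0 := by
  refine Lp.ext ?_
  have h1 : ∀ᵐ η : Space d, ∀ N : ℕ, η ∈ lowFreq d β N → F η = 0 := by
    rw [ae_all_iff]
    intro N
    filter_upwards [coeFn_cutoff (β := β) N 0 F, Lp.coeFn_zero ℂ 2 (volume : Measure (Space d))]
      with η h1 h2 h3
    rw [h N, h2, indicator_of_mem h3] at h1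
    simpa using h1.symm
  filter_upwards [h1, Lp.coeFn_zero ℂ 2 (volume : Measure (Space d))] with η h2 h3
  obtain ⟨N, hN⟩ := exists_nat_ge (freq β η)
  rw [h2 N hN, h3, Pi.zero_apply]

lemma IsWeakSolution.eqOn (hc : ContinuousOn c (Ioi 0)) (hc0 : ∀ t, 0 < t → 0 ≤ c t)
    {u w : ℝ → L2 d} (hu : IsWeakSolution β c f u) (hw : IsWeakSolution β c f w) :
    EqOn w u (Ici 0) := by
  obtain ⟨v, hu1, hv, hu0, hv0, huE, huw⟩ := hu
  obtain ⟨v', hw1, hv', hw0, hv0', hwE, hww⟩ := hw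
  intro t ht
  rw [← sub_eq_zero]
  refine (Lp.fourierTransformₗᵢ (Space d) ℂ).map_eq_zero_iff.1
    (eq_zero_of_cutoff (β := β) fun N => ?_)
  set Q : L2 d →L[ℂ] L2 d := (cutoff d β N 0).comp
    (Lp.fourierTransformₗᵢ (Space d) ℂ).toContinuousLinearEquiv.toContinuousLinearMap with hQ
  -- The adjoint of `Q` takes values in the form domain, so the weak equation is available for every
  -- `G` after projection.
  have hQi : ∀ G x : L2 d, inner ℂ G (Q x) = inner ℂ (𝓕⁻ (cutoff d β N 0 G) : L2 d) x :=
    fun G x => by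
      rw [← Lp.inner_fourier_eq (𝓕⁻ (cutoff d β N 0 G) : L2 d) x,
        FourierTransform.fourier_fourierInv_eq, inner_cutoff]
      rfl
  refine eq_zero_of_energy (cutoff d β N 2) (inner_cutoff N 2) (inner_cutoff_nonneg N 2) hc hc0
    (u := fun s => Q (w s - u s)) (v := fun s => Q (v' s - v s)) (fun s hs => ?_) ?_ ?_ ?_ ?_ t ht
  · exact (Q.restrictScalars ℝ).hasFDerivAt.comp_hasDerivWithinAt s ((hw1 s hs).sub (hu1 s hs))
  · exact Q.continuous.comp_continuousOn (hv'.sub hv)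
  · rw [hu0, hw0, sub_self, map_zero]
  · rw [hv0, hv0', sub_self, map_zero]
  · intro G s hs
    have hE := energyDomain_cutoff (β := β) N G
    have h1 := (hww _ hE s hs).sub (huw _ hE s hs)
    rw [energyForm_cutoff, energyForm_cutoff] at h1
    have h2 : (fun r => inner ℂ G (Q (v' r - v r))) = fun r =>
        (inner ℂ (𝓕⁻ (cutoff d β N 0 G) : L2 d) (v' r) : ℂ) -
          inner ℂ (𝓕⁻ (cutoff d β N 0 G) : L2 d) (v r) := by
      funext r
      rw [hQi, inner_sub_right]
    rw [h2]
    refine h1.congr_deriv ?_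
    have h3 : (inner ℂ G (cutoff d β N 2 (Q (w s - u s))) : ℂ) =
        inner ℂ G (cutoff d β N 2 (cutoff d β N 0 (𝓕 (w s) : L2 d))) -
          inner ℂ G (cutoff d β N 2 (cutoff d β N 0 (𝓕 (u s) : L2 d))) := by
      rw [map_sub, map_sub, inner_sub_right]
      rfl
    rw [h3, hQi, inner_sub_right]
    ring

lemma IsStrongSolution.isWeakSolution (hf : EnergyDomain β f) {u : ℝ → L2 d}
    (hu : IsStrongSolution β c f u) : IsWeakSolution β c f u := by
  obtain ⟨v, a, hu1, hv, hu0, hv0, hva, -, heq⟩ := hu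
  refine ⟨v, hu1, hv, hu0, hv0, fun t ht => ?_, fun g _ t ht => ?_⟩
  -- The strong equation says nothing at `t = 0`; there the form domain comes from the datum.
  · rcases ht.eq_or_lt with rfl | ht
    · rwa [hu0]
    · obtain ⟨h, hh, -⟩ := heq t ht
      exact hh.energyDomain
  · obtain ⟨h, hh, hah⟩ := heq t ht
    rw [energyForm_eq_inner_laplacian hh]
    have h1 := ((innerSL ℂ g).restrictScalars ℝ).hasFDerivAt.comp_hasDerivAt t (hva t ht)
    refine h1.congr_deriv ?_
    have h2 : a t = -((c t : ℂ) • v t) - h := by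
      rw [eq_sub_iff_add_eq, eq_neg_iff_add_eq_zero, ← hah]
      abel
    rw [h2]
    change inner ℂ g _ = _
    rw [inner_sub_right, inner_neg_right, inner_smul_right]

end Uniqueness

/-! ### Existence from a profile -/

section Existence

variable {d : ℕ} {β : ℝ}

/-- The function with Fourier transform `φ(t ‖2πη‖^{β/2}) 𝓕f(η)`. -/
def evolve (β : ℝ) (φ : ℝ → ℝ) (f : L2 d) (t : ℝ) : L2 d :=
  (𝓕⁻ (mulL2 (fun η => φ (t * freq β η)) (𝓕 f : L2 d)) : L2 d)

lemma fourier_evolve (φ : ℝ → ℝ) (f : L2 d) (t : ℝ) :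
    (𝓕 (evolve β φ f t) : L2 d) = mulL2 (fun η => φ (t * freq β η)) (𝓕 f : L2 d) :=
  FourierTransform.fourier_fourierInv_eq _

lemma mulL2_combination {α : Type*} [MeasurableSpace α] {ν : Measure α} {m₁ m₂ m₃ : α → ℝ}
    {F : Lp ℂ 2 ν} (c : ℝ) (h₁ : MemLp (fun a => (m₁ a : ℂ) * F a) 2 ν)
    (h₂ : MemLp (fun a => (m₂ a : ℂ) * F a) 2 ν) (h₃ : MemLp (fun a => (m₃ a : ℂ) * F a) 2 ν)
    (h : ∀ a, m₁ a + c * m₂ a + m₃ a = 0) :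
    mulL2 m₁ F + (c : ℂ) • mulL2 m₂ F + mulL2 m₃ F = 0 := by
  refine Lp.ext ?_
  filter_upwards [coeFn_mulL2 h₁, coeFn_mulL2 h₂, coeFn_mulL2 h₃,
    Lp.coeFn_add (mulL2 m₁ F + (c : ℂ) • mulL2 m₂ F) (mulL2 m₃ F),
    Lp.coeFn_add (mulL2 m₁ F) ((c : ℂ) • mulL2 m₂ F), Lp.coeFn_smul (c : ℂ) (mulL2 m₂ F),
    Lp.coeFn_zero ℂ 2 ν] with a e1 e2 e3 e4 e5 e6 e7
  rw [e4, Pi.add_apply, e5, Pi.add_apply, e6, Pi.smul_apply, e1, e2, e3, e7, smul_eq_mul,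
    ← mul_assoc, ← add_mul, ← add_mul, ← Complex.ofReal_mul, ← Complex.ofReal_add,
    ← Complex.ofReal_add, h, Complex.ofReal_zero, zero_mul, Pi.zero_apply]

lemma hasDerivAt_fourierInv {w : ℝ → L2 d} {w' : L2 d} {t : ℝ} (h : HasDerivAt w w' t) :
    HasDerivAt (fun s => (𝓕⁻ (w s) : L2 d)) (𝓕⁻ w' : L2 d) t :=
  ((Lp.fourierTransformₗᵢ (Space d) ℂ).symm.toContinuousLinearEquiv.toContinuousLinearMap
    |>.restrictScalars ℝ).hasFDerivAt.comp_hasDerivAt t h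

variable {a : ℝ} {φ φ₁ φ₂ : ℝ → ℝ} {f : L2 d} {c : ℝ → ℝ}

lemma IsProfile.continuous (hφ : IsProfile a φ φ₁ φ₂) : Continuous φ :=
  continuous_iff_continuousAt.2 fun z => (hφ.deriv₀ z).continuousAt

lemma IsProfile.continuous₁ (hφ : IsProfile a φ φ₁ φ₂) : Continuous φ₁ :=
  continuous_iff_continuousAt.2 fun z => (hφ.deriv₁ z).continuousAt

lemma measurable_freq_comp {ψ : ℝ → ℝ} (hψ : Continuous ψ) (t : ℝ) :
    Measurable fun η : Space d => ψ (t * freq β η) :=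
  hψ.measurable.comp (measurable_freq.const_mul t)

lemma abs_pow_mul_le {ψ : ℝ → ℝ} (hψ : ∀ z, |ψ z| ≤ 1) (n : ℕ) (t : ℝ) (η : Space d) :
    |freq β η ^ n * ψ (t * freq β η)| ≤ freq β η ^ n := by
  rw [abs_mul, abs_pow, abs_of_nonneg (freq_nonneg η)]
  exact mul_le_of_le_one_right (pow_nonneg (freq_nonneg η) n) (hψ _)

lemma continuous_mulL2_freq {ψ : ℝ → ℝ} {n : ℕ} {F : L2 d}
    (hF : MemLp (fun η => ((freq β η ^ n : ℝ) : ℂ) * F η) 2) (hψ : Continuous ψ)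
    (hb : ∀ z, |ψ z| ≤ 1) :
    Continuous fun t => mulL2 (fun η => freq β η ^ n * ψ (t * freq β η)) F :=
  continuous_mulL2 (fun t => (measurable_freq.pow_const n).mul (measurable_freq_comp hψ t)) hF
    (abs_pow_mul_le hb n) (fun η => by fun_prop)

lemma memLp_freq {ψ : ℝ → ℝ} {n : ℕ} {F : L2 d}
    (hF : MemLp (fun η => ((freq β η ^ n : ℝ) : ℂ) * F η) 2) (hψ : Continuous ψ)
    (hb : ∀ z, |ψ z| ≤ 1) (t : ℝ) :
    MemLp (fun η => ((freq β η ^ n * ψ (t * freq β η) : ℝ) : ℂ) * F η) 2 :=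
  memLp_mul_of_le ((measurable_freq.pow_const n).mul (measurable_freq_comp hψ t)) hF
    (abs_pow_mul_le hb n t)

/-- The chain rule in `t` brings out one factor `freq`; with `|ψ'| ≤ 1`, the function `freq ^ (n +
1)` dominates. -/
lemma hasDerivAt_mulL2_freq {ψ ψ' : ℝ → ℝ} {n : ℕ} {F : L2 d}
    (hF : MemLp (fun η => ((freq β η ^ n : ℝ) : ℂ) * F η) 2)
    (hF' : MemLp (fun η => ((freq β η ^ (n + 1) : ℝ) : ℂ) * F η) 2)
    (hψ : ∀ z, HasDerivAt ψ (ψ' z) z) (hψ' : Continuous ψ') (hb : ∀ z, |ψ z| ≤ 1)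
    (hb' : ∀ z, |ψ' z| ≤ 1) (t : ℝ) :
    HasDerivAt (fun s => mulL2 (fun η => freq β η ^ n * ψ (s * freq β η)) F)
      (mulL2 (fun η => freq β η ^ (n + 1) * ψ' (t * freq β η)) F) t := by
  have hc : Continuous ψ := continuous_iff_continuousAt.2 fun z => (hψ z).continuousAt
  refine hasDerivAt_mulL2 (G := fun s η => freq β η ^ n * ψ (s * freq β η))
    (G' := fun s η => freq β η ^ (n + 1) * ψ' (s * freq β η))
    (fun t => (measurable_freq.pow_const n).mul (measurable_freq_comp hc t))
    (fun t => (measurable_freq.pow_const _).mul (measurable_freq_comp hψ' t)) hF'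
    (abs_pow_mul_le hb' _) (memLp_freq hF hc hb) (fun t η => ?_) t
  have := ((hψ (t * freq β η)).comp t ((hasDerivAt_id t).mul_const (freq β η))).const_mul
    (freq β η ^ n)
  refine this.congr_deriv ?_
  ring

lemma memLp_freq_zero (F : L2 d) : MemLp (fun η => ((freq β η ^ 0 : ℝ) : ℂ) * F η) 2 := by
  simpa using Lp.memLp F

lemma EnergyDomain.memLp_freq_one (hf : EnergyDomain β f) :
    MemLp (fun η => ((freq β η ^ 1 : ℝ) : ℂ) * (𝓕 f : L2 d) η) 2 := by
  simpa using energyDomain_iff.1 hf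

lemma mulL2_freq_mulL2 {ψ : ℝ → ℝ} (hψ : Continuous ψ) (hb : ∀ z, |ψ z| ≤ 1) {n : ℕ} {F : L2 d}
    (hF : MemLp (fun η => ((freq β η ^ n : ℝ) : ℂ) * F η) 2) (t : ℝ) :
    (fun η => ((freq β η ^ n : ℝ) : ℂ) * mulL2 (fun η => ψ (t * freq β η)) F η) =ᵐ[volume]
      mulL2 (fun η => freq β η ^ n * ψ (t * freq β η)) F := by
  filter_upwards [coeFn_mulL2 (memLp_freq hF hψ hb t),
    coeFn_mulL2 (memLp_mul_of_bounded (F := F) (measurable_freq_comp (β := β) hψ t)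
      (fun _ => hb _))] with η h1 h2
  rw [h1, h2]
  push_cast
  ring

lemma energyDomain_evolve (hφ : IsProfile a φ φ₁ φ₂) (hf : EnergyDomain β f) (t : ℝ) :
    EnergyDomain β (evolve β φ f t) := by
  rw [energyDomain_iff, fourier_evolve]
  refine (Lp.memLp _).ae_eq
    ((mulL2_freq_mulL2 hφ.continuous hφ.bound₀ hf.memLp_freq_one t).symm.trans ?_)
  simp only [pow_one]
  rfl

lemma evolve_zero (hφ : IsProfile a φ φ₁ φ₂) : evolve β φ f 0 = f := by
  simp only [evolve, zero_mul, hφ.zero₀, mulL2_one]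
  exact FourierTransform.fourierInv_fourier_eq f

/-- The first derivative of `evolve`, as a function of time. -/
def evolve₁ (β : ℝ) (φ₁ : ℝ → ℝ) (f : L2 d) (t : ℝ) : L2 d :=
  (𝓕⁻ (mulL2 (fun η => freq β η ^ 1 * φ₁ (t * freq β η)) (𝓕 f : L2 d)) : L2 d)

/-- The second derivative of `evolve`, as a function of time. -/
def evolve₂ (β : ℝ) (φ₂ : ℝ → ℝ) (f : L2 d) (t : ℝ) : L2 d :=
  (𝓕⁻ (mulL2 (fun η => freq β η ^ 2 * φ₂ (t * freq β η)) (𝓕 f : L2 d)) : L2 d)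

lemma continuous_fourierInv : Continuous fun F : L2 d => (𝓕⁻ F : L2 d) :=
  (Lp.fourierTransformₗᵢ (Space d) ℂ).symm.continuous

lemma continuous_evolve (hφ : IsProfile a φ φ₁ φ₂) : Continuous (evolve β φ f) := by
  have h := continuous_mulL2_freq (β := β) (memLp_freq_zero (𝓕 f : L2 d)) hφ.continuous hφ.bound₀
  simp only [pow_zero, one_mul] at h
  exact continuous_fourierInv.comp h

lemma hasDerivAt_evolve (hφ : IsProfile a φ φ₁ φ₂) (hf : EnergyDomain β f) (t : ℝ) :
    HasDerivAt (evolve β φ f) (evolve₁ β φ₁ f t) t := by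
  have h := hasDerivAt_mulL2_freq (β := β) (memLp_freq_zero (𝓕 f : L2 d)) hf.memLp_freq_one
    hφ.deriv₀ hφ.continuous₁ hφ.bound₀ hφ.bound₁ t
  simp only [pow_zero, one_mul, zero_add] at h
  exact hasDerivAt_fourierInv h

lemma continuous_evolve₁ (hφ : IsProfile a φ φ₁ φ₂) (hf : EnergyDomain β f) :
    Continuous (evolve₁ β φ₁ f) :=
  continuous_fourierInv.comp (continuous_mulL2_freq hf.memLp_freq_one hφ.continuous₁ hφ.bound₁)

lemma evolve₁_zero (hφ : IsProfile a φ φ₁ φ₂) : evolve₁ β φ₁ f 0 = 0 := by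
  simp only [evolve₁, zero_mul, hφ.zero₁, mul_zero, mulL2_zero]
  exact (Lp.fourierTransformₗᵢ (Space d) ℂ).symm.map_zero

/-- The weak equation uses `n = 0`, one power of `freq` having moved to the test function; the
strong one uses `n = 1`. -/
lemma IsProfile.ode_freq (hφ : IsProfile a φ φ₁ φ₂) {c t : ℝ} (ht : 0 < t) (hc : t * c = a)
    (n : ℕ) (η : Space d) : freq β η ^ (n + 1) * φ₂ (t * freq β η) +
      c * (freq β η ^ n * φ₁ (t * freq β η)) + freq β η ^ (n + 1) * φ (t * freq β η) = 0 := by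
  have h := hφ.ode (t * freq β η)
  rw [← hc] at h
  have h2 : t * (freq β η * φ₂ (t * freq β η) + c * φ₁ (t * freq β η) +
      freq β η * φ (t * freq β η)) = 0 := by
    rw [← h]
    ring
  rw [mul_eq_zero, or_iff_right ht.ne'] at h2
  calc _ = freq β η ^ n * (freq β η * φ₂ (t * freq β η) + c * φ₁ (t * freq β η) +
      freq β η * φ (t * freq β η)) := by ring
    _ = 0 := by rw [h2, mul_zero]

lemma isWeakSolution_evolve (hφ : IsProfile a φ φ₁ φ₂) (hf : EnergyDomain β f)
    (hc : ∀ t, 0 < t → t * c t = a) : IsWeakSolution β c f (evolve β φ f) := by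
  refine ⟨evolve₁ β φ₁ f, fun t _ => (hasDerivAt_evolve hφ hf t).hasDerivWithinAt,
    (continuous_evolve₁ hφ hf).continuousOn, evolve_zero hφ, evolve₁_zero hφ,
    fun t _ => energyDomain_evolve hφ hf t, fun g hg t ht => ?_⟩
  have hF := memLp_freq_zero (β := β) (𝓕 f : L2 d)
  have hF1 := hf.memLp_freq_one
  -- For `f` only in the form domain, `freq ^ 2 * 𝓕 f` need not be in `L²`. Moving one `freq` onto
  -- `g` leaves a multiplier that can be differentiated in norm.
  have hv : ∀ s, (inner ℂ g (evolve₁ β φ₁ f s) : ℂ) = inner ℂ (mulL2 (freq β) (𝓕 g : L2 d))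
      (mulL2 (fun η => freq β η ^ 0 * φ₁ (s * freq β η)) (𝓕 f : L2 d)) := fun s => by
    rw [← Lp.inner_fourier_eq, evolve₁, FourierTransform.fourier_fourierInv_eq]
    refine inner_mulL2_eq (memLp_freq hF1 hφ.continuous₁ hφ.bound₁ s) (energyDomain_iff.1 hg)
      (memLp_freq hF hφ.continuous₁ hφ.bound₁ s) fun η => ?_
    rw [pow_one, pow_zero, one_mul]
  have hd := hasDerivAt_mulL2_freq hF hF1 hφ.deriv₁ hφ.cont₂ hφ.bound₁ hφ.bound₂ t
  have h1 := ((innerSL ℂ (mulL2 (freq β) (𝓕 g : L2 d))).restrictScalars ℝ).hasFDerivAt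
    |>.comp_hasDerivAt t hd
  simp_rw [hv]
  refine h1.congr_deriv ?_
  have hcomb := mulL2_combination (c t) (memLp_freq hF1 hφ.cont₂ hφ.bound₂ t)
    (memLp_freq hF hφ.continuous₁ hφ.bound₁ t) (memLp_freq hF1 hφ.continuous hφ.bound₀ t)
    (hφ.ode_freq ht (hc t ht) 0)
  have hu : mulL2 (freq β) (𝓕 (evolve β φ f t) : L2 d) =
      mulL2 (fun η => freq β η ^ 1 * φ (t * freq β η)) (𝓕 f : L2 d) := by
    refine Lp.ext ((coeFn_mulL2 (energyDomain_iff.1 (energyDomain_evolve hφ hf t))).trans ?_)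
    refine EventuallyEq.trans ?_ (mulL2_freq_mulL2 hφ.continuous hφ.bound₀ hF1 t)
    rw [fourier_evolve]
    simp only [pow_one]
    rfl
  rw [energyForm_eq_inner hg (energyDomain_evolve hφ hf t), hu]
  rw [zero_add] at *
  rw [add_assoc, add_eq_zero_iff_eq_neg] at hcomb
  change inner ℂ (mulL2 (freq β) (𝓕 g : L2 d))
    (mulL2 (fun η => freq β η ^ 1 * φ₂ (t * freq β η)) (𝓕 f : L2 d)) = _
  rw [hcomb, inner_neg_right, inner_add_right, inner_smul_right]
  ring

lemma isStrongSolution_evolve (hφ : IsProfile a φ φ₁ φ₂) {g : L2 d} (hg : IsFracLaplacian β f g)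
    (hc : ∀ t, 0 < t → t * c t = a) : IsStrongSolution β c f (evolve β φ f) := by
  have hf := hg.energyDomain
  have hF1 := hf.memLp_freq_one
  have hF2 := hg.memLp
  refine ⟨evolve₁ β φ₁ f, evolve₂ β φ₂ f,
    fun t _ => (hasDerivAt_evolve hφ hf t).hasDerivWithinAt,
    (continuous_evolve₁ hφ hf).continuousOn, evolve_zero hφ, evolve₁_zero hφ, fun t _ => ?_, ?_,
    -- With `φ` in place of `φ₂`, the multiplier of `evolve₂` is `freq² φ`, that is, `(-Δ)^{β/2}`
    -- applied to the solution.
    fun t ht => ⟨evolve₂ β φ f t, ?_, ?_⟩⟩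
  · exact hasDerivAt_fourierInv
      (hasDerivAt_mulL2_freq hF1 hF2 hφ.deriv₁ hφ.cont₂ hφ.bound₁ hφ.bound₂ t)
  · exact (continuous_fourierInv.comp
      (continuous_mulL2_freq hF2 hφ.cont₂ hφ.bound₂)).continuousOn
  · rw [isFracLaplacian_iff, fourier_evolve, evolve₂, FourierTransform.fourier_fourierInv_eq]
    exact (mulL2_freq_mulL2 hφ.continuous hφ.bound₀ hF2 t).symm
  · have hcomb := mulL2_combination (c t) (memLp_freq hF2 hφ.cont₂ hφ.bound₂ t)
      (memLp_freq hF1 hφ.continuous₁ hφ.bound₁ t) (memLp_freq hF2 hφ.continuous hφ.bound₀ t)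
      (hφ.ode_freq ht (hc t ht) 1)
    have h := congrArg (Lp.fourierTransformₗᵢ (Space d) ℂ).symm hcomb
    rw [map_add, map_add, map_smul, map_zero] at h
    exact h

lemma hat_evolve (hφ : IsProfile a φ φ₁ φ₂) (f : L2 d) (t : ℝ) : ∀ᵐ ξ : Space d,
    hat (evolve β φ f t) ξ = (φ (t * ‖ξ‖ ^ (β / 2)) : ℂ) * hat f ξ := by
  have h := coeFn_mulL2 (memLp_mul_of_bounded (F := (𝓕 f : L2 d))
    (measurable_freq_comp (β := β) hφ.continuous t) (fun _ => hφ.bound₀ _))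
  filter_upwards [ae_dilation_iff.2 h] with ξ hξ
  rw [hat, fourier_evolve, hξ, freq_dilation, hat]

end Existence

/-! ### The Poisson integral with the Beta kernel -/

section BetaKernel

variable {lam : ℝ}

lemma image_sq_Ioo : (fun w : ℝ => w ^ 2) '' Ioo 0 1 = Ioo 0 1 := by
  ext x
  constructor
  · rintro ⟨w, hw, rfl⟩
    exact ⟨pow_pos hw.1 2, pow_lt_one₀ hw.1.le hw.2 (by norm_num)⟩
  · intro hx
    exact ⟨√x, ⟨Real.sqrt_pos.2 hx.1, (Real.sqrt_lt' one_pos).2 (by simpa using hx.2)⟩,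
      Real.sq_sqrt hx.1.le⟩

/-- Under `x = w²` the Jacobian `2w` cancels the singularity `x^{-1/2}` of the density. -/
lemma abs_deriv_smul_betaPDFReal {w : ℝ} (hw : w ∈ Ioo (0 : ℝ) 1) :
    |2 * w| * betaPDFReal (1 / 2) lam (w ^ 2) =
      2 / beta (1 / 2) lam * (1 - w ^ 2) ^ (lam - 1) := by
  have hmem : 0 < w ^ 2 ∧ w ^ 2 < 1 :=
    ⟨pow_pos hw.1 2, pow_lt_one₀ hw.1.le hw.2 (by norm_num)⟩
  have h1 : (w ^ 2) ^ ((1 : ℝ) / 2 - 1) = w⁻¹ := by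
    rw [← Real.rpow_natCast, ← Real.rpow_mul hw.1.le, ← Real.rpow_neg_one]
    norm_num
  have := hw.1
  rw [betaPDFReal, if_pos hmem, h1, abs_of_pos (by linarith)]
  field_simp

lemma integrableOn_beta_kernel (hlam : 0 < lam) :
    IntegrableOn (fun w : ℝ => (1 - w ^ 2) ^ (lam - 1)) (Ioo 0 1) := by
  have hb := beta_pos (α := 1 / 2) (β := lam) (by norm_num) hlam
  have hint : IntegrableOn (betaPDFReal (1 / 2) lam) (Ioo 0 1) := by
    refine Integrable.integrableOn ?_
    -- A non-integrable function has Bochner integral `0` by convention, but this integral is `1`.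
    by_contra h
    have h1 := integral_betaPDFReal (a := 1 / 2) (by norm_num) hlam
    rw [integral_undef h] at h1
    exact zero_ne_one h1
  rw [← image_sq_Ioo, integrableOn_image_iff_integrableOn_abs_deriv_smul measurableSet_Ioo
    (f' := fun w => 2 * w) (fun w _ => by simpa using (hasDerivAt_pow 2 w).hasDerivWithinAt)
    (fun x hx y hy h => (pow_left_inj₀ hx.1.le hy.1.le (by norm_num)).1 h)] at hint
  refine IntegrableOn.congr_fun (hint.const_mul (beta (1 / 2) lam / 2)) (fun w hw => ?_)
    measurableSet_Ioo
  simp only [smul_eq_mul]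
  rw [abs_deriv_smul_betaPDFReal hw]
  field_simp

lemma integral_betaMeasure_sqrt (hlam : 0 < lam) (g : ℝ → ℝ) :
    ∫ x, g √x ∂(betaMeasure (1 / 2) lam) =
      2 / beta (1 / 2) lam * ∫ w in Ioo (0 : ℝ) 1, (1 - w ^ 2) ^ (lam - 1) * g w := by
  rw [integral_betaMeasure (by norm_num) hlam]
  have h0 : ∫ x, betaPDFReal (1 / 2) lam x • g √x =
      ∫ x in Ioo 0 1, betaPDFReal (1 / 2) lam x • g √x := by
    refine (setIntegral_eq_integral_of_forall_compl_eq_zero fun x hx => ?_).symm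
    rw [betaPDFReal, if_neg (show ¬(0 < x ∧ x < 1) from hx), zero_smul]
  rw [h0]
  conv_lhs => rw [← image_sq_Ioo]
  rw [integral_image_eq_integral_abs_deriv_smul measurableSet_Ioo
    (f' := fun w => 2 * w) (fun w _ => by simpa using (hasDerivAt_pow 2 w).hasDerivWithinAt)
    (fun x hx y hy h => (pow_left_inj₀ hx.1.le hy.1.le (by norm_num)).1 h), ← integral_const_mul]
  refine setIntegral_congr_fun measurableSet_Ioo fun w hw => ?_
  simp only [smul_eq_mul]
  rw [Real.sqrt_sq hw.1.le, ← mul_assoc, abs_deriv_smul_betaPDFReal hw, mul_assoc]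

/-- The kernel `(1 - s²)^{lam - 1} cos(z s)` of the Poisson integral. -/
def poissonKernel (lam z s : ℝ) : ℝ := (1 - s ^ 2) ^ (lam - 1) * Real.cos (z * s)

lemma poissonKernel_neg (lam z s : ℝ) : poissonKernel lam z (-s) = poissonKernel lam z s := by
  simp [poissonKernel]

lemma intervalIntegrable_poissonKernel (hlam : 0 < lam) (z : ℝ) :
    IntervalIntegrable (poissonKernel lam z) volume 0 1 := by
  rw [intervalIntegrable_iff_integrableOn_Ioo_of_le zero_le_one]
  refine (integrableOn_beta_kernel hlam).mul_bdd (c := 1) ?_ ?_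
  · exact (by fun_prop : Continuous fun s => Real.cos (z * s)).aestronglyMeasurable
  · exact ae_of_all _ fun s => Real.abs_cos_le_one _

lemma intervalIntegrable_poissonKernel_neg (hlam : 0 < lam) (z : ℝ) :
    IntervalIntegrable (poissonKernel lam z) volume (-1) 0 := by
  have h := (IntervalIntegrable.iff_comp_neg (by finiteness)).1
    (IntervalIntegrable.symm (intervalIntegrable_poissonKernel hlam z))
  simpa only [poissonKernel_neg, neg_zero] using h

lemma epdProfile_eq_integral (hlam : 0 < lam) (z : ℝ) :
    epdProfile lam z = 1 / beta lam (1 / 2) * ∫ s in (-1)..1, poissonKernel lam z s := by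
  have h1 : ∫ s in (-1)..0, poissonKernel lam z s = ∫ s in 0..1, poissonKernel lam z s := by
    have h := intervalIntegral.integral_comp_neg (a := -1) (b := 0) (poissonKernel lam z)
    simpa only [poissonKernel_neg, neg_zero, neg_neg] using h
  have h2 : beta lam (1 / 2) = beta (1 / 2) lam := by
    rw [beta, beta, mul_comm, add_comm]
  rw [← intervalIntegral.integral_add_adjacent_intervals
    (intervalIntegrable_poissonKernel_neg hlam z) (intervalIntegrable_poissonKernel hlam z), h1,
    intervalIntegral.integral_of_le zero_le_one, integral_Ioc_eq_integral_Ioo, epdProfile,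
    integral_betaMeasure_sqrt hlam fun w => Real.cos (z * w), h2]
  simp only [poissonKernel]
  ring

lemma beta_kernel_eq (r : ℝ) (w t : ℝ) (ht : t ≠ 0) (A : ℂ) :
    (((1 - w ^ 2 / t ^ 2) ^ (lam - 1) : ℝ) : ℂ) *
      ((Complex.exp (Complex.I * (r : ℝ) * w) + Complex.exp (-(Complex.I * (r : ℝ) * w))) / 2) * A =
    ((poissonKernel lam (t * r) (w / t) : ℝ) : ℂ) * A := by
  have h1 : Complex.cos (r * w) =
      (Complex.exp (Complex.I * (r : ℝ) * w) + Complex.exp (-(Complex.I * (r : ℝ) * w))) / 2 := by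
    rw [Complex.cos]
    ring_nf
  have h2 : t * r * (w / t) = r * w := by field_simp
  rw [← h1, poissonKernel, h2, div_pow]
  push_cast
  rfl

lemma intervalIntegrable_beta_kernel (hlam : 0 < lam) {t : ℝ} (ht : 0 < t) (r : ℝ) (A : ℂ) :
    IntervalIntegrable (fun w : ℝ => (((1 - w ^ 2 / t ^ 2) ^ (lam - 1) : ℝ) : ℂ) *
      ((Complex.exp (Complex.I * (r : ℝ) * w) + Complex.exp (-(Complex.I * (r : ℝ) * w))) / 2) * A)
      volume (-t) t := by
  simp only [beta_kernel_eq _ _ _ ht.ne']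
  have h1 := IntervalIntegrable.comp_mul_right (c := t⁻¹)
    (IntervalIntegrable.trans (intervalIntegrable_poissonKernel_neg hlam (t * r))
      (intervalIntegrable_poissonKernel hlam (t * r)))
  rw [neg_div, one_div, inv_inv] at h1
  simp only [← div_eq_mul_inv] at h1
  have h2 : IntervalIntegrable (fun w => ((poissonKernel lam (t * r) (w / t) : ℝ) : ℂ))
      volume (-t) t := ⟨h1.1.ofReal, h1.2.ofReal⟩
  exact h2.mul_const A

lemma epdProfile_mul_eq_integral (hlam : 0 < lam) {t : ℝ} (ht : 0 < t) (r : ℝ) (A : ℂ) :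
    (epdProfile lam (t * r) : ℂ) * A = ((1 / (beta lam (1 / 2) * t) : ℝ) : ℂ) * ∫ w in (-t)..t,
      (((1 - w ^ 2 / t ^ 2) ^ (lam - 1) : ℝ) : ℂ) *
        ((Complex.exp (Complex.I * (r : ℝ) * w) + Complex.exp (-(Complex.I * (r : ℝ) * w))) / 2) *
          A := by
  simp only [beta_kernel_eq _ _ _ ht.ne']
  rw [intervalIntegral.integral_mul_const, intervalIntegral.integral_ofReal,
    intervalIntegral.integral_comp_div _ ht.ne', neg_div, div_self ht.ne',
    epdProfile_eq_integral hlam, ← mul_assoc, ← Complex.ofReal_mul, smul_eq_mul]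
  congr 2
  field_simp

end BetaKernel

/-! ### The stochastic representation -/

section Stochastic

variable {Ω : Type*} [MeasurableSpace Ω] {P : Measure Ω}

/-- From `|F| ≤ 1 + |F|²`; all that matters is a bound uniform on bounded subsets of `L²`. -/
lemma setIntegral_norm_le {α : Type*} [MeasurableSpace α] {ν : Measure α} (F : Lp ℂ 2 ν)
    {s : Set α} (hs : ν s < ⊤) : ∫ x in s, ‖F x‖ ∂ν ≤ ν.real s + ‖F‖ ^ 2 := by
  have hF := (memLp_two_iff_integrable_sq_norm (Lp.aestronglyMeasurable F)).1 (Lp.memLp F)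
  have h1 : ∫ x, ‖F x‖ ^ 2 ∂ν = ‖F‖ ^ 2 := by
    have h := inner_self_eq_norm_sq_to_K (𝕜 := ℂ) F
    rw [L2.inner_def] at h
    simp_rw [inner_self_eq_norm_sq_to_K] at h
    have h2 : ((∫ x, ‖F x‖ ^ 2 ∂ν : ℝ) : ℂ) = ((‖F‖ ^ 2 : ℝ) : ℂ) := by
      rw [← integral_complex_ofReal]
      push_cast
      exact h
    exact_mod_cast h2
  have hfin : IsFiniteMeasure (ν.restrict s) := ⟨by rwa [Measure.restrict_apply_univ]⟩
  have hFs : Integrable F (ν.restrict s) := ((Lp.memLp F).restrict s).integrable (by norm_num)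
  calc ∫ x in s, ‖F x‖ ∂ν ≤ ∫ x in s, (1 + ‖F x‖ ^ 2) ∂ν := by
        refine integral_mono hFs.norm ((integrable_const _).add hF.integrableOn) fun x => ?_
        change ‖F x‖ ≤ 1 + ‖F x‖ ^ 2
        nlinarith [sq_nonneg (‖F x‖ - 1), norm_nonneg (F x)]
    _ = ν.real s + ∫ x in s, ‖F x‖ ^ 2 ∂ν := by
        rw [integral_add (integrable_const _) hF.integrableOn]
        simp
    _ ≤ ν.real s + ‖F‖ ^ 2 := by
        rw [← h1]
        gcongr
        · exact ae_of_all _ fun x => sq_nonneg _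
        · exact Measure.restrict_le_self

/-- For a bounded family in `L²` with a jointly measurable version, the Bochner integral is given
by the pointwise integrals at almost every point. -/
lemma ae_integral_eq_of_version {α : Type*} [MeasurableSpace α] [IsProbabilityMeasure P]
    {ν : Measure α} [SigmaFinite ν] {W : Ω → Lp ℂ 2 ν} {V : Ω → α → ℂ} {C : ℝ}
    (hW : Integrable W P) (hC : ∀ ω, ‖W ω‖ ≤ C) (hV : Measurable (Function.uncurry V))
    (hVW : ∀ᵐ ω ∂P, V ω =ᵐ[ν] W ω) :
    ∀ᵐ x ∂ν, Integrable (fun ω => V ω x) P ∧ (∫ ω, W ω ∂P : Lp ℂ 2 ν) x = ∫ ω, V ω x ∂P := by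
  -- Fubini needs joint integrability, which holds over sets of finite measure because `L²` embeds
  -- there in `L¹`; σ-finiteness then covers the space.
  have hprod : ∀ s, MeasurableSet s → ν s < ⊤ →
      Integrable (Function.uncurry V) (P.prod (ν.restrict s)) := by
    intro s hs hνs
    have : IsFiniteMeasure (ν.restrict s) := ⟨by rwa [Measure.restrict_apply_univ]⟩
    have hWs : ∀ ω, Integrable (W ω) (ν.restrict s) := fun ω =>
      ((Lp.memLp (W ω)).restrict s).integrable (by norm_num)
    rw [integrable_prod_iff hV.aestronglyMeasurable]
    constructor
    · filter_upwards [hVW] with ω hω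
      exact (hWs ω).congr (ae_restrict_of_ae hω.symm)
    · refine Integrable.of_bound (C := ν.real s + C ^ 2) ?_ ?_
      · exact (hV.norm.stronglyMeasurable.integral_prod_right
          (ν := ν.restrict s)).aestronglyMeasurable
      · filter_upwards [hVW] with ω hω
        rw [Real.norm_of_nonneg (integral_nonneg fun _ => norm_nonneg _)]
        have h1 : ∫ x in s, ‖Function.uncurry V (ω, x)‖ ∂ν = ∫ x in s, ‖W ω x‖ ∂ν := by
          refine integral_congr_ae ?_
          filter_upwards [ae_restrict_of_ae hω] with x hx
          rw [Function.uncurry_apply_pair, hx]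
        rw [h1]
        refine (setIntegral_norm_le (W ω) hνs).trans ?_
        gcongr
        exact hC ω
  have hint : ∀ᵐ x ∂ν, Integrable (fun ω => V ω x) P := by
    have h : ∀ᵐ x ∂(ν.restrict (⋃ n, spanningSets ν n)), Integrable (fun ω => V ω x) P := by
      rw [ae_restrict_iUnion_iff]
      exact fun n => (hprod _ (measurableSet_spanningSets ν n)
        (measure_spanningSets_lt_top ν n)).prod_left_ae
    rwa [iUnion_spanningSets, Measure.restrict_univ] at h
  have heq : (∫ ω, W ω ∂P : Lp ℂ 2 ν) =ᵐ[ν] fun x => ∫ ω, V ω x ∂P := by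
    refine ae_eq_of_forall_setIntegral_eq_of_sigmaFinite (fun s hs hνs => ?_) (fun s hs hνs => ?_)
      fun s hs hνs => ?_
    · have : IsFiniteMeasure (ν.restrict s) := ⟨by rwa [Measure.restrict_apply_univ]⟩
      exact ((Lp.memLp _).restrict s).integrable (by norm_num)
    · exact (hprod s hs hνs).integral_prod_right
    -- Integration over `s` is pairing with its indicator, a continuous functional that passes
    -- through the Bochner integral.
    · rw [← L2.inner_indicatorConstLp_one (𝕜 := ℂ) hs hνs.ne, ← integral_inner hW,
        integral_integral_swap (f := fun x ω => V ω x) (hprod s hs hνs).swap]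
      refine integral_congr_ae ?_
      filter_upwards [hVW] with ω hω
      rw [L2.inner_indicatorConstLp_one]
      exact integral_congr_ae (ae_restrict_of_ae hω.symm)
  filter_upwards [hint, heq] with x h1 h2
  exact ⟨h1, h2⟩

variable {d : ℕ} {β lam : ℝ} {f : L2 d}

lemma norm_evolve_le {a : ℝ} {φ φ₁ φ₂ : ℝ → ℝ} (hφ : IsProfile a φ φ₁ φ₂) (t : ℝ) :
    ‖evolve β φ f t‖ ≤ ‖f‖ := by
  rw [← Lp.norm_fourier_eq, fourier_evolve, ← Lp.norm_fourier_eq f]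
  refine Lp.norm_le_norm_of_ae_le ?_
  filter_upwards [coeFn_mulL2 (memLp_mul_of_bounded (F := (𝓕 f : L2 d))
    (measurable_freq_comp (β := β) hφ.continuous t) (fun _ => hφ.bound₀ _))] with η h
  rw [h, norm_mul, Complex.norm_real]
  exact mul_le_of_le_one_left (norm_nonneg _) (hφ.bound₀ _)

lemma integrable_evolve_cos [IsFiniteMeasure P] {Y : Ω → ℝ} (hY : AEMeasurable Y P) :
    Integrable (fun ω => evolve β Real.cos f (Y ω)) P :=
  Integrable.of_bound (C := ‖f‖)
    ((continuous_evolve isProfile_cos).comp_aestronglyMeasurable hY.aestronglyMeasurable)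
    (ae_of_all _ fun _ => norm_evolve_le isProfile_cos _)

lemma inner_evolve {a : ℝ} {φ φ₁ φ₂ : ℝ → ℝ} (hφ : IsProfile a φ φ₁ φ₂) (g : L2 d) (t : ℝ) :
    inner ℂ g (evolve β φ f t) = ∫ η, (φ (t * freq β η) : ℂ) *
      ((starRingEnd ℂ) ((𝓕 g : L2 d) η) * (𝓕 f : L2 d) η) := by
  rw [← Lp.inner_fourier_eq, fourier_evolve]
  exact inner_mulL2 _ (memLp_mul_of_bounded (measurable_freq_comp hφ.continuous t)
    (fun _ => hφ.bound₀ _))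

/-- Tested against `g`, both sides become integrals over frequency, and Fubini moves the Beta
average onto the cosine. -/
lemma evolve_epdProfile_eq_integral (hlam : 0 < lam) (t : ℝ) :
    evolve β (epdProfile lam) f t =
      ∫ x, evolve β Real.cos f (t * √x) ∂(betaMeasure (1 / 2) lam) := by
  have := isProbabilityMeasureBeta (α := 1 / 2) (by norm_num) hlam
  refine ext_inner_left ℂ fun g => ?_
  have hY : Measurable fun x : ℝ => t * √x := by fun_prop
  rw [← integral_inner (integrable_evolve_cos (P := betaMeasure (1 / 2) lam) hY.aemeasurable)]
  simp_rw [inner_evolve isProfile_cos, inner_evolve (isProfile_epdProfile hlam)]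
  have hK : Integrable fun η => (starRingEnd ℂ) ((𝓕 g : L2 d) η) * (𝓕 f : L2 d) η := by
    refine (L2.integrable_inner (𝕜 := ℂ) (𝓕 g : L2 d) (𝓕 f : L2 d)).congr (ae_of_all _ fun η => ?_)
    simp only [RCLike.inner_apply]
    ring
  rw [integral_integral_swap]
  · refine integral_congr_ae (ae_of_all _ fun η => ?_)
    have h : ∀ x : ℝ, t * √x * freq β η = t * freq β η * √x := fun x => mul_right_comm _ _ _
    simp only [h]
    rw [integral_mul_const, integral_complex_ofReal, epdProfile]
  · refine (hK.comp_snd (betaMeasure (1 / 2) lam)).bdd_mul (c := 1) ?_ ?_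
    · have hm : Measurable fun p : ℝ × Space d => Real.cos (t * √p.1 * freq β p.2) := by
        have : Measurable fun p : ℝ × Space d => freq β p.2 := measurable_freq.comp measurable_snd
        fun_prop
      exact (Complex.measurable_ofReal.comp hm).aestronglyMeasurable
    · refine ae_of_all _ fun p => ?_
      rw [Complex.norm_real]
      exact Real.abs_cos_le_one _

end Stochastic

end FracEPD

end

/-! ### Assembly -/

theorem mainTheorem7 (d : ℕ) (hd : 0 < d) (β : ℝ) (hβ : 0 < β) (hβ2 : β ≤ 2)
    (lam : ℝ) (hlam : 0 < lam) (f : FracEPD.L2 d) (hf : FracEPD.EnergyDomain β f)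
    {Ω : Type*} [MeasurableSpace Ω] (P : Measure Ω) [IsProbabilityMeasure P] (X : Ω → ℝ)
    (hX : HasLaw X (betaMeasure (1 / 2) lam) P) :
    ∃ u ubar : ℝ → FracEPD.L2 d,
      -- `u` is the unique solution of the space-fractional EPD problem
      FracEPD.IsWeakSolution β (FracEPD.epdCoeff lam) f u ∧
      (∀ w, FracEPD.IsWeakSolution β (FracEPD.epdCoeff lam) f w → EqOn w u (Ici 0)) ∧
      -- `ubar` is the unique solution of the wave problem with the same data
      FracEPD.IsWeakSolution β FracEPD.waveCoeff f ubar ∧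
      (∀ w, FracEPD.IsWeakSolution β FracEPD.waveCoeff f w → EqOn w ubar (Ici 0)) ∧
      -- both are strong solutions, unique as such, if `f` is in the operator domain
      ((∃ h, FracEPD.IsFracLaplacian β f h) →
        FracEPD.IsStrongSolution β (FracEPD.epdCoeff lam) f u ∧
        (∀ w, FracEPD.IsStrongSolution β (FracEPD.epdCoeff lam) f w → EqOn w u (Ici 0)) ∧
        FracEPD.IsStrongSolution β FracEPD.waveCoeff f ubar ∧
        (∀ w, FracEPD.IsStrongSolution β FracEPD.waveCoeff f w → EqOn w ubar (Ici 0))) ∧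
      -- the Fourier transform of `u` through the Bessel function
      (∀ t : ℝ, 0 < t → ∀ᵐ ξ : FracEPD.Space d,
        FracEPD.hat (u t) ξ =
          (((2 / (t * ‖ξ‖ ^ (β / 2))) ^ (lam - 1 / 2) * Real.Gamma (lam + 1 / 2) *
            FracEPD.besselJ (lam - 1 / 2) (t * ‖ξ‖ ^ (β / 2)) : ℝ) : ℂ) * FracEPD.hat f ξ) ∧
      -- the Fourier transform of `u` through the Beta kernel
      (∀ t : ℝ, 0 < t → ∀ᵐ ξ : FracEPD.Space d,
        IntervalIntegrable (fun w : ℝ =>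
          (((1 - w ^ 2 / t ^ 2) ^ (lam - 1) : ℝ) : ℂ) *
            ((Complex.exp (Complex.I * (‖ξ‖ ^ (β / 2) : ℝ) * w) +
              Complex.exp (-(Complex.I * (‖ξ‖ ^ (β / 2) : ℝ) * w))) / 2) * FracEPD.hat f ξ)
          volume (-t) t ∧
        FracEPD.hat (u t) ξ =
          ((1 / (beta lam (1 / 2) * t) : ℝ) : ℂ) * ∫ w in (-t)..t,
            (((1 - w ^ 2 / t ^ 2) ^ (lam - 1) : ℝ) : ℂ) *
              ((Complex.exp (Complex.I * (‖ξ‖ ^ (β / 2) : ℝ) * w) +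
                Complex.exp (-(Complex.I * (‖ξ‖ ^ (β / 2) : ℝ) * w))) / 2) * FracEPD.hat f ξ) ∧
      -- the wave solution as an inverse Fourier transform
      (∀ t : ℝ, 0 ≤ t → ∀ᵐ ξ : FracEPD.Space d,
        FracEPD.hat (ubar t) ξ = (Real.cos (t * ‖ξ‖ ^ (β / 2)) : ℂ) * FracEPD.hat f ξ) ∧
      -- the stochastic representation in `L²`
      (∀ t : ℝ, 0 ≤ t → Integrable (fun ω => ubar (t * √(X ω))) P ∧
        u t = ∫ ω, ubar (t * √(X ω)) ∂P) ∧
      -- the stochastic representation at almost every point `x`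
      (∀ U : ℝ → FracEPD.Space d → ℂ, Measurable (Function.uncurry U) →
        (∀ s : ℝ, 0 ≤ s → U s =ᵐ[volume] ubar s) →
        ∀ t : ℝ, 0 ≤ t → ∀ᵐ x : FracEPD.Space d,
          Integrable (fun ω => U (t * √(X ω)) x) P ∧
          u t x = ∫ ω, U (t * √(X ω)) x ∂P) := by
  have := isProbabilityMeasureBeta (α := 1 / 2) (by norm_num) hlam
  have hE := FracEPD.isProfile_epdProfile hlam
  have hC := FracEPD.isProfile_cos
  have hc1 : ContinuousOn (FracEPD.epdCoeff lam) (Ioi 0) :=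
    continuousOn_const.div continuousOn_id fun t ht => ne_of_gt ht
  have hc1' : ∀ t, 0 < t → 0 ≤ FracEPD.epdCoeff lam t := fun t ht =>
    div_nonneg (by linarith) ht.le
  have hc2 : ContinuousOn FracEPD.waveCoeff (Ioi 0) := continuousOn_const
  have hc2' : ∀ t, 0 < t → 0 ≤ FracEPD.waveCoeff t := fun t _ => le_rfl
  have ha1 : ∀ t, 0 < t → t * FracEPD.epdCoeff lam t = 2 * lam := fun t ht => by
    rw [FracEPD.epdCoeff]
    field_simp
  have ha2 : ∀ t, 0 < t → t * FracEPD.waveCoeff t = 0 := fun t _ => mul_zero t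
  have hw1 := FracEPD.isWeakSolution_evolve hE hf ha1
  have hw2 := FracEPD.isWeakSolution_evolve hC hf ha2
  have hYlaw : ∀ t : ℝ, Measurable fun x : ℝ => t * √x := fun t => by fun_prop
  refine ⟨FracEPD.evolve β (FracEPD.epdProfile lam) f, FracEPD.evolve β Real.cos f, hw1,
    fun w hw => hw1.eqOn hc1 hc1' hw, hw2, fun w hw => hw2.eqOn hc2 hc2' hw,
    fun ⟨h, hh⟩ => ⟨FracEPD.isStrongSolution_evolve hE hh ha1,
      fun w hw => hw1.eqOn hc1 hc1' (hw.isWeakSolution hf),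
      FracEPD.isStrongSolution_evolve hC hh ha2,
      fun w hw => hw2.eqOn hc2 hc2' (hw.isWeakSolution hf)⟩,
    fun t ht => ?_, fun t ht => ?_, fun t _ => FracEPD.hat_evolve hC f t, fun t _ => ?_,
    fun U hU hUu t ht => ?_⟩
  -- For `d ≥ 1` the point `ξ = 0`, where the Bessel formula degenerates, is a null set.
  · have : Nonempty (Fin d) := ⟨⟨0, hd⟩⟩
    filter_upwards [FracEPD.hat_evolve hE f t, Measure.ae_ne volume (0 : FracEPD.Space d)]
      with ξ h1 h2
    have hξ : 0 < t * ‖ξ‖ ^ (β / 2) := mul_pos ht (Real.rpow_pos_of_pos (norm_pos_iff.2 h2) _)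
    rw [h1, FracEPD.epdProfile_eq_besselJ hlam hξ]
  · filter_upwards [FracEPD.hat_evolve hE f t] with ξ h1
    refine ⟨FracEPD.intervalIntegrable_beta_kernel hlam ht _ _, ?_⟩
    rw [h1, FracEPD.epdProfile_mul_eq_integral hlam ht]
  · have hY : AEMeasurable (fun ω => t * √(X ω)) P :=
      (hYlaw t).comp_aemeasurable hX.aemeasurable
    refine ⟨FracEPD.integrable_evolve_cos hY, ?_⟩
    rw [FracEPD.evolve_epdProfile_eq_integral hlam]
    exact (hX.integral_comp ((FracEPD.continuous_evolve hC).comp_aestronglyMeasurable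
      (hYlaw t).aestronglyMeasurable)).symm
  · have hUm : Measurable (Function.uncurry fun (x : ℝ) (y : FracEPD.Space d) => U (t * √x) y) :=
      hU.comp (((hYlaw t).comp measurable_fst).prodMk measurable_snd)
    have h := FracEPD.ae_integral_eq_of_version (P := betaMeasure (1 / 2) lam)
      (W := fun x => FracEPD.evolve β Real.cos f (t * √x)) (V := fun x => U (t * √x))
      (FracEPD.integrable_evolve_cos (hYlaw t).aemeasurable)
      (fun x => FracEPD.norm_evolve_le hC _) hUm
      (Filter.Eventually.of_forall fun x => hUu _ (mul_nonneg ht (Real.sqrt_nonneg x)))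
    filter_upwards [h] with y hy
    -- The pointwise statement is proved for the Beta law on the line and transported to `P` through
    -- the law of `X`.
    have hm : AEStronglyMeasurable (fun x : ℝ => U (t * √x) y) (betaMeasure (1 / 2) lam) :=
      hy.1.aestronglyMeasurable
    constructor
    · have h1 := hy.1
      rw [← hX.map_eq] at h1 hm
      exact (integrable_map_measure hm hX.aemeasurable).1 h1
    · rw [FracEPD.evolve_epdProfile_eq_integral hlam, hy.2]
      exact (hX.integral_comp hm).symm
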